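/- Let $X$ be a Noetherian scheme (for example a nonsingular projective 3-fold over $\mathbb C$), and let $\iota\colon C\hookrightarrow X$ be a Cohen–Macaulay curve in $X$, that is, a nonempty closed subscheme whose local rings are Cohen–Macaulay and all of whose irreducible components have dimension $1$. Let $\mathfrak m\subset\mathcal O_C$ be the ideal sheaf of a closed subscheme of $C$ of dimension $\le 0$. Sheaves on $C$ are regarded as sheaves on $X$ by pushforward. A stable pair $(F,s)$ on $X$ is a coherent sheaf $F$ that is pure of dimension $1$ (every nonzero coherent subsheaf has support of dimension $1$) together with a section $s\colon\mathcal O_X\to F$ whose cokernel has support of dimension $\le 0$. It has support $C$ if the annihilator ideal of $F$ is the ideal sheaf of $C$. Two pairs are isomorphic if there is an isomorphism of sheaves carrying one section to the other. Let $\mathcal S$ be the collection of stable pairs $(F,s)$ with support $C$ such that $\mathrm{Supp}(\mathrm{coker}\, s)\subset\mathrm{Supp}(\mathcal O_C/\mathfrak m)$ as sets. For $r\ge 0$ let $\mathcal O_C\to\mathcal Hom(\mathfrak m^r,\mathcal O_C)$ be the canonical map, sending $1$ to the inclusion $\mathfrak m^r\subset\mathcal O_C$, and let $\mathcal Hom(\mathfrak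 m^r,\mathcal O_C)/\mathcal O_C$ be its cokernel. For a subsheaf $Q$ of $\mathcal Hom(\mathfrak m^r,\mathcal O_C)/\mathcal O_C$ let $F_Q\subset\mathcal Hom(\mathfrak m^r,\mathcal O_C)$ be its inverse image, with the section $s_Q\colon\mathcal O_X\to\mathcal O_C\to F_Q$. Then: 1. For every $r$ and every coherent subsheaf $Q\subset\mathcal Hom(\mathfrak m^r,\mathcal O_C)/\mathcal O_C$, the pair $(F_Q,s_Q)$ belongs to $\mathcal S$, and the sequence $0\to\mathcal O_C\to F_Q\to Q\to0$ is exact. 2. For every $r$, if $Q$ and $Q'$ are coherent subsheaves of $\mathcal Hom(\mathfrak m^r,\mathcal O_C)/\mathcal O_C$ with $(F_Q,s_Q)\cong(F_{Q'},s_{Q'})$, then $Q=Q'$. 3. For every $(F,s)\in\mathcal S$ there is an $r_0$ such that for every $r\ge r_0$ there is a coherent subsheaf $Q\subset\mathcal Hom(\mathfrak m^r,\mathcal O_C)/\mathcal O_C$ with $(F,s)\cong(F_Q,s_Q)$. 4. For $r\le r'$ the map $\mathcal Hom(\mathfrak m^r,\mathcal O_C)/\mathcal O_C\to\mathcal Hom(\mathfrak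 m^{r'},\mathcal O_C)/\mathcal O_C$ given by restriction of homomorphisms is injective, and if $Q$ is a coherent subsheaf of the source and $Q'$ its image, then $Q'$ is coherent and $(F_Q,s_Q)\cong(F_{Q'},s_{Q'})$. Thus isomorphism classes in $\mathcal S$ correspond bijectively to coherent subsheaves of $\mathcal Hom(\mathfrak m^r,\mathcal O_C)/\mathcal O_C$, $r\gg0$. -/

import Mathlib

open AlgebraicGeometry CategoryTheory Limits TopologicalSpace Opposite

universe u

namespace StablePairs

noncomputable section

/-! ### The sheaf of homomorphisms -/

section

/-- Sections over `U` of the sheaf `ℋom(M, N)`: families of `𝒪_X(V)`-linear maps `M(V) → N(V)`, one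
for every open `V ⊆ U`, compatible with restriction (that is, morphisms `M|_U ⟶ N|_U`). -/
def homSections {X : Scheme.{u}} (M N : X.Modules) (U : X.Opens) :
    AddSubgroup (∀ V : {V : X.Opens // V ≤ U}, Γ(M, V.1) →ₗ[Γ(X, V.1)] Γ(N, V.1)) where
  carrier := {φ | ∀ (V W : {V : X.Opens // V ≤ U}) (h : W.1 ≤ V.1) (x : Γ(M, V.1)),
    φ W (M.presheaf.map (homOfLE h).op x) = N.presheaf.map (homOfLE h).op (φ V x)}
  add_mem' {φ ψ} hφ hψ V W h x := by simp [hφ V W h x, hψ V W h x]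
  zero_mem' V W h x := by simp
  neg_mem' {φ} hφ V W h x := by simp [hφ V W h x]

variable {X : Scheme.{u}} (M N : X.Modules)

instance (U : X.Opens) : SMul Γ(X, U) (homSections M N U) where
  smul a φ := ⟨fun V => X.presheaf.map (homOfLE V.2).op a • φ.1 V, fun V W h x => by
    simp only [LinearMap.smul_apply, Scheme.Modules.map_smul]
    rw [φ.2 V W h x, ← CategoryTheory.comp_apply, ← Functor.map_comp]
    rfl⟩

lemma homSections_smul_apply {U : X.Opens} (a : Γ(X, U)) (φ : homSections M N U)
    (V : {V : X.Opens // V ≤ U}) :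
    (a • φ).1 V = X.presheaf.map (homOfLE V.2).op a • φ.1 V := rfl

instance (U : X.Opens) : Module Γ(X, U) (homSections M N U) where
  one_smul φ := Subtype.ext (funext fun V => by simp [homSections_smul_apply])
  mul_smul a b φ := Subtype.ext (funext fun V => by simp [homSections_smul_apply, mul_smul])
  smul_zero a := Subtype.ext (funext fun V => by simp [homSections_smul_apply])
  smul_add a φ ψ := Subtype.ext (funext fun V => by simp [homSections_smul_apply])
  add_smul a b φ := Subtype.ext (funext fun V => by simp [homSections_smul_apply, add_smul])
  zero_smul φ := Subtype.ext (funext fun V => by simp [homSections_smul_apply])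

/-- Restriction of homomorphisms to a smaller open set. -/
def homRes {U V : X.Opens} (h : V ≤ U) : homSections M N U →+ homSections M N V where
  toFun φ := ⟨fun W => φ.1 ⟨W.1, W.2.trans h⟩, fun W W' h' x => φ.2 ⟨W.1, _⟩ ⟨W'.1, _⟩ h' x⟩
  map_zero' := rfl
  map_add' _ _ := rfl

/-- The abelian presheaf underlying the sheaf of homomorphisms. -/
def homPresheaf : TopCat.Presheaf Ab.{u} X where
  obj U := AddCommGrpCat.of (homSections M N U.unop)
  map f := AddCommGrpCat.ofHom (homRes M N f.unop.le)
  map_id _ := rfl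
  map_comp _ _ := rfl

lemma isSheaf_homPresheaf : (homPresheaf M N).IsSheaf := by
  rw [TopCat.Presheaf.isSheaf_iff_isSheafUniqueGluing]
  intro I U φ hφ
  let H : TopCat.Sheaf Ab X := ⟨N.presheaf, N.isSheaf⟩
  have agree (i j : I) (W : X.Opens) (hi : W ≤ U i) (hj : W ≤ U j) :
      (φ i).1 ⟨W, hi⟩ = (φ j).1 ⟨W, hj⟩ :=
    congr_fun (congr_arg Subtype.val (hφ i j)) ⟨W, le_inf hi hj⟩
  have cover (V : X.Opens) (hV : V ≤ iSup U) : V ≤ ⨆ i, V ⊓ U i := by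
    rw [← inf_iSup_eq]; exact le_inf le_rfl hV
  have key (V : {V : X.Opens // V ≤ iSup U}) (x : Γ(M, V.1)) :
      ∃! y : Γ(N, V.1), ∀ i, N.presheaf.map (homOfLE (inf_le_left : V.1 ⊓ U i ≤ V.1)).op y =
        (φ i).1 ⟨V.1 ⊓ U i, inf_le_right⟩
          (M.presheaf.map (homOfLE (inf_le_left : V.1 ⊓ U i ≤ V.1)).op x) := by
    refine H.existsUnique_gluing' (fun i => V.1 ⊓ U i) V.1 (fun i => homOfLE inf_le_left)
      (cover _ V.2) _ fun i j => ?_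
    have h1 := (φ i).2 ⟨V.1 ⊓ U i, inf_le_right⟩
      ⟨(V.1 ⊓ U i) ⊓ (V.1 ⊓ U j), inf_le_left.trans inf_le_right⟩ inf_le_left
      (M.presheaf.map (homOfLE (inf_le_left : V.1 ⊓ U i ≤ V.1)).op x)
    have h2 := (φ j).2 ⟨V.1 ⊓ U j, inf_le_right⟩
      ⟨(V.1 ⊓ U i) ⊓ (V.1 ⊓ U j), inf_le_right.trans inf_le_right⟩ inf_le_right
      (M.presheaf.map (homOfLE (inf_le_left : V.1 ⊓ U j ≤ V.1)).op x)
    refine h1.symm.trans (Eq.trans ?_ h2)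
    rw [agree i j, ← CategoryTheory.comp_apply, ← Functor.map_comp,
      ← CategoryTheory.comp_apply, ← Functor.map_comp]
    rfl
  choose f hf hf' using key
  have loc (V : {V : X.Opens // V ≤ iSup U}) (y z : Γ(N, V.1))
      (h : ∀ i, N.presheaf.map (homOfLE (inf_le_left : V.1 ⊓ U i ≤ V.1)).op y =
        N.presheaf.map (homOfLE (inf_le_left : V.1 ⊓ U i ≤ V.1)).op z) : y = z :=
    H.eq_of_locally_eq' (fun i => V.1 ⊓ U i) V.1 (fun i => homOfLE inf_le_left)
      (cover _ V.2) _ _ h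
  let ψ : homSections M N (iSup U) :=
    ⟨fun V =>
      { toFun := f V
        map_add' := fun x y => loc V _ _ fun i => by simp [hf]
        map_smul' := fun a x => loc V _ _ fun i => by simp [hf, Scheme.Modules.map_smul] },
    fun V W h x => loc W _ _ fun i => by
      have h1 := (φ i).2 ⟨V.1 ⊓ U i, inf_le_right⟩ ⟨W.1 ⊓ U i, inf_le_right⟩
        (inf_le_inf_right _ h) (M.presheaf.map (homOfLE (inf_le_left : V.1 ⊓ U i ≤ V.1)).op x)
      rw [← hf V x i] at h1
      refine (hf W _ i).trans (Eq.trans ?_ (h1.trans ?_))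
      · rw [← CategoryTheory.comp_apply, ← Functor.map_comp,
          ← CategoryTheory.comp_apply, ← Functor.map_comp]
        rfl
      · rw [← CategoryTheory.comp_apply, ← Functor.map_comp]
        change _ = N.presheaf.map _ (N.presheaf.map _ (f V x))
        rw [← CategoryTheory.comp_apply, ← Functor.map_comp]
        rfl⟩
  refine ⟨ψ, fun i => Subtype.ext (funext fun V => LinearMap.ext fun x => ?_), fun ψ' hψ' =>
    Subtype.ext (funext fun V => LinearMap.ext fun x => hf' V x _ fun i => ?_)⟩
  · refine (hf' ⟨V.1, V.2.trans (le_iSup U i)⟩ x _ fun j => ?_).symm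
    rw [← agree i j _ (inf_le_left.trans V.2)]
    exact ((φ i).2 V ⟨V.1 ⊓ U j, inf_le_left.trans V.2⟩ inf_le_left x).symm
  · refine (ψ'.2 V ⟨V.1 ⊓ U i, inf_le_right.trans (le_iSup U i)⟩ inf_le_left x).symm.trans ?_
    have h := congr_fun (congr_arg Subtype.val (hψ' i)) ⟨V.1 ⊓ U i, inf_le_right⟩
    exact congr($h _)

instance (U : X.Opensᵒᵖ) : Module (X.ringCatSheaf.obj.obj U) ((homPresheaf M N).obj U) :=
  inferInstanceAs (Module Γ(X, U.unop) (homSections M N U.unop))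


lemma homRes_smul {U V : X.Opens} (h : V ≤ U) (a : Γ(X, U)) (φ : homSections M N U) :
    homRes M N h (a • φ) = X.presheaf.map (homOfLE h).op a • homRes M N h φ := by
  refine Subtype.ext (funext fun W => LinearMap.ext fun x => ?_)
  change X.presheaf.map (homOfLE (W.2.trans h)).op a • φ.1 ⟨W.1, W.2.trans h⟩ x =
    X.presheaf.map (homOfLE W.2).op (X.presheaf.map (homOfLE h).op a) •
      φ.1 ⟨W.1, W.2.trans h⟩ x
  rw [← CategoryTheory.comp_apply, ← Functor.map_comp]
  rfl

/-- The sheaf `ℋom(M, N)` of `𝒪_X`-module homomorphisms. -/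
def sheafHom : X.Modules where
  val := PresheafOfModules.ofPresheaf (homPresheaf M N) fun _ _ f a φ =>
    homRes_smul M N f.unop.le a φ
  isSheaf := isSheaf_homPresheaf M N

end

/-- The morphism of `𝒪_X`-modules given by linear maps on sections compatible with restriction. -/
def mkHom {X : Scheme.{u}} {M N : X.Modules}
    (f : ∀ U : X.Opens, Γ(M, U) →ₗ[Γ(X, U)] Γ(N, U))
    (hf : ∀ (U V : X.Opens) (h : V ≤ U) (x : Γ(M, U)),
      f V (M.presheaf.map (homOfLE h).op x) = N.presheaf.map (homOfLE h).op (f U x)) :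
    M ⟶ N :=
  ⟨PresheafOfModules.homMk
    { app := fun U => AddCommGrpCat.ofHom (f U.unop).toAddMonoidHom
      naturality := fun U V g => by
        ext x
        exact hf U.unop V.unop g.unop.le x }
    fun U r m => (f U.unop).map_smul r m⟩

variable {M} in
/-- The map on sections over `U` induced by a morphism of `𝒪_X`-modules. -/
def appLinear {X : Scheme.{u}} {M N : X.Modules} (p : M ⟶ N) (U : X.Opens) :
    Γ(M, U) →ₗ[Γ(X, U)] Γ(N, U) where
  toFun := p.app U
  map_add' x y := map_add _ x y
  map_smul' a x := p.app_smul a x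

/-- Precomposition with `p : M ⟶ M'`, as a morphism `ℋom(M', N) ⟶ ℋom(M, N)`. -/
def sheafHomPrecomp {X : Scheme.{u}} {M M' : X.Modules} (N : X.Modules) (p : M ⟶ M') :
    sheafHom M' N ⟶ sheafHom M N :=
  mkHom
    (fun U =>
      { toFun := fun φ : homSections M' N U =>
          (⟨fun V => (φ.1 V).comp (appLinear p V.1), fun V W h x => by
            refine Eq.trans ?_ (φ.2 V W h (p.app V.1 x))
            exact congr_arg (φ.1 W) congr($(p.mapPresheaf.naturality (homOfLE h).op) x)⟩ :
            homSections M N U)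
        map_add' := fun _ _ => Subtype.ext (funext fun _ => LinearMap.ext fun _ => rfl)
        map_smul' := fun _ _ => Subtype.ext (funext fun _ => LinearMap.ext fun _ => rfl) })
    (fun _ _ _ _ => rfl)

/-! ### Structure sheaves and ideal sheaves as modules -/

/-- The structure sheaf as a module over itself. -/
abbrev structureSheaf (X : Scheme.{u}) : X.Modules := SheafOfModules.unit X.ringCatSheaf

/-- Sections over an arbitrary open `U` of the quasi-coherent sheaf of ideals `I`: the functions on
`U` that lie in the given ideal on every affine open contained in `U`. -/
def idealSections {C : Scheme.{u}} (I : C.IdealSheafData) (U : C.Opens) : Ideal Γ(C, U) :=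
  ⨅ V : {V : C.affineOpens // V.1 ≤ U}, (I.ideal V.1).comap (C.presheaf.map (homOfLE V.2).op).hom

lemma mem_idealSections {C : Scheme.{u}} (I : C.IdealSheafData) {U : C.Opens} (f : Γ(C, U)) :
    f ∈ idealSections I U ↔ ∀ (V : C.affineOpens) (h : V.1 ≤ U),
      C.presheaf.map (homOfLE h).op f ∈ I.ideal V := by
  simp [idealSections, Subtype.forall]

lemma idealSections_affine {C : Scheme.{u}} (I : C.IdealSheafData) (U : C.affineOpens) :
    idealSections I U.1 = I.ideal U := by
  ext f
  rw [mem_idealSections]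
  refine ⟨fun h => ?_, fun h V hV => I.ideal_le_comap_ideal hV h⟩
  simpa using h U le_rfl

lemma idealSections_res {C : Scheme.{u}} (I : C.IdealSheafData) {U V : C.Opens} (h : V ≤ U)
    {f : Γ(C, U)} (hf : f ∈ idealSections I U) :
    C.presheaf.map (homOfLE h).op f ∈ idealSections I V := by
  rw [mem_idealSections] at hf ⊢
  intro W hW
  rw [← CategoryTheory.comp_apply, ← Functor.map_comp]
  exact hf W (hW.trans h)

lemma idealSections_local {C : Scheme.{u}} (I : C.IdealSheafData) {ι : Type*} (U : ι → C.Opens)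
    (f : Γ(C, iSup U))
    (hf : ∀ i, C.presheaf.map (homOfLE (le_iSup U i)).op f ∈ idealSections I (U i)) :
    f ∈ idealSections I (iSup U) := by
  rw [mem_idealSections]
  intro V hV
  rw [V.2.mem_ideal_iff]
  intro x hx
  obtain ⟨i, hi⟩ := Opens.mem_iSup.mp (hV hx)
  obtain ⟨_, ⟨W, hW, rfl⟩, hxW, hWV⟩ := C.isBasis_affineOpens.exists_subset_of_mem_open
    (show x ∈ V.1 ⊓ U i from ⟨hx, hi⟩) (V.1 ⊓ U i).2
  have hWV' : W ≤ V.1 ⊓ U i := hWV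
  have h1 := (mem_idealSections I _).1 (hf i) ⟨W, hW⟩ (hWV'.trans inf_le_right)
  rw [← CategoryTheory.comp_apply, ← Functor.map_comp] at h1
  have h2 : (I.ideal V).map (C.presheaf.map (homOfLE (hWV'.trans inf_le_left)).op).hom =
      I.ideal ⟨W, hW⟩ := I.map_ideal (U := ⟨W, hW⟩) (V := V) (hWV'.trans inf_le_left)
  rw [← h2] at h1
  have h3 := Ideal.mem_map_of_mem (C.presheaf.germ W x hxW).hom h1
  rw [Ideal.map_map, ← CommRingCat.hom_comp, show C.presheaf.map
    (homOfLE (hWV'.trans inf_le_left)).op ≫ C.presheaf.germ W x hxW = C.presheaf.germ V.1 x hx from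
    C.presheaf.germ_res (homOfLE (hWV'.trans inf_le_left)) x hxW] at h3
  convert h3 using 1
  exact (C.presheaf.germ_res_apply (homOfLE hV) x hx f).trans
    (C.presheaf.germ_res_apply (homOfLE ((hWV'.trans inf_le_left).trans hV)) x hxW f).symm

lemma idealSections_mono {C : Scheme.{u}} {I J : C.IdealSheafData} (h : I ≤ J) (U : C.Opens) :
    idealSections I U ≤ idealSections J U := fun f hf => by
  rw [mem_idealSections] at hf ⊢
  exact fun V hV => h V (hf V hV)

/-- The sheaf of ideals `I`, as a sub-presheaf of modules of `𝒪_C`. -/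
def idealSubmodule {C : Scheme.{u}} (I : C.IdealSheafData) :
    (structureSheaf C).val.Submodule where
  obj U := idealSections I U.unop
  map f _ hx := idealSections_res I f.unop.le hx

/-- A quasi-coherent sheaf of ideals `I ⊆ 𝒪_C`, as an `𝒪_C`-module. -/
def idealModule {C : Scheme.{u}} (I : C.IdealSheafData) : C.Modules where
  val := (idealSubmodule I).toPresheafOfModules
  isSheaf := by
    change TopCat.Presheaf.IsSheaf (X := C.toTopCat) _
    rw [TopCat.Presheaf.isSheaf_iff_isSheafUniqueGluing]
    intro J U s hs
    change ∀ j, idealSections I (U j) at s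
    obtain ⟨f, hf, hf'⟩ := C.sheaf.existsUnique_gluing U (fun j => (s j).1)
      (fun i j => congr_arg Subtype.val (hs i j))
    exact ⟨(⟨f, idealSections_local I U f fun j => by
        have h := (s j).2
        rwa [← show _ = (s j).1 from hf j] at h⟩ : idealSections I (iSup U)),
      fun j => Subtype.ext (hf j),
      fun g hg => Subtype.ext (hf' g.1 fun j => congr_arg Subtype.val (hg j))⟩

/-- A section of `I`, viewed as a function. -/
def idealVal {C : Scheme.{u}} {I : C.IdealSheafData} {U : C.Opens} (g : Γ(idealModule I, U)) :
    Γ(C, U) := g.1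

/-- The inclusion `J ⊆ I` of sheaves of ideals, as a morphism of modules. -/
def idealInclusion {C : Scheme.{u}} {J I : C.IdealSheafData} (h : J ≤ I) :
    idealModule J ⟶ idealModule I :=
  ⟨PresheafOfModules.Submodule.homOfLE fun U => idealSections_mono h U.unop⟩

/-! ### The sheaves `ℋom(I, 𝒪_C)` and `ℋom(I, 𝒪_C)/𝒪_C` on `X`

Sheaves on the closed subscheme `ι : C ⟶ X` are regarded as sheaves on `X` by pushforward. -/

section

variable {X C : Scheme.{u}} (ι : C ⟶ X)

/-- `𝒪_C`, as a sheaf on `X`. -/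
abbrev curveSheaf : X.Modules := (Scheme.Modules.pushforward ι).obj (structureSheaf C)

/-- The canonical map `𝒪_X ⟶ 𝒪_C`. -/
abbrev curveSection : structureSheaf X ⟶ curveSheaf ι :=
  SheafOfModules.unitToPushforwardObjUnit ι.toRingCatSheafHom

/-- The sheaf of ideals `I ⊆ 𝒪_C`, as a sheaf on `X`. -/
abbrev idealOn (I : C.IdealSheafData) : X.Modules :=
  (Scheme.Modules.pushforward ι).obj (idealModule I)

/-- The sheaf `ℋom(I, 𝒪_C)` on `X`. -/
abbrev idealDual (I : C.IdealSheafData) : X.Modules := sheafHom (idealOn ι I) (curveSheaf ι)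

/-- Multiplication by `f ∈ 𝒪_C(U)`, as a map `I(U) → 𝒪_C(U)`. -/
def mulLinear (I : C.IdealSheafData) (U : X.Opens) (f : Γ(C, ι ⁻¹ᵁ U)) :
    Γ(idealOn ι I, U) →ₗ[Γ(X, U)] Γ(curveSheaf ι, U) where
  toFun g := (f * idealVal g : Γ(C, ι ⁻¹ᵁ U))
  map_add' g h := mul_add f (idealVal g) (idealVal h)
  map_smul' a g := mul_left_comm f (ι.app U a) (idealVal g)

/-- Multiplication by `f ∈ 𝒪_C(U)`, as a section of `ℋom(I, 𝒪_C)` over `U`. -/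
def mulSection (I : C.IdealSheafData) (U : X.Opens) (f : Γ(C, ι ⁻¹ᵁ U)) :
    homSections (idealOn ι I) (curveSheaf ι) U :=
  ⟨fun V => mulLinear ι I V.1 (C.presheaf.map (homOfLE (ι.preimage_mono V.2)).op f),
    fun V W h g => by
      change C.presheaf.map _ f * C.presheaf.map _ (idealVal g) =
        C.presheaf.map (homOfLE (ι.preimage_mono h)).op (C.presheaf.map _ f * idealVal g)
      rw [map_mul, ← CategoryTheory.comp_apply, ← Functor.map_comp]
      rfl⟩

lemma mulSection_add (I : C.IdealSheafData) (U : X.Opens) (f f' : Γ(C, ι ⁻¹ᵁ U)) :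
    mulSection ι I U (f + f') = mulSection ι I U f + mulSection ι I U f' :=
  Subtype.ext <| funext fun V => LinearMap.ext fun g => by
    change C.presheaf.map _ (f + f') * idealVal g = C.presheaf.map _ f * idealVal g +
      C.presheaf.map _ f' * idealVal g
    rw [map_add, add_mul]

lemma mulSection_smul (I : C.IdealSheafData) (U : X.Opens) (a : Γ(X, U)) (f : Γ(C, ι ⁻¹ᵁ U)) :
    mulSection ι I U (ι.app U a * f) = a • mulSection ι I U f :=
  Subtype.ext <| funext fun V => LinearMap.ext fun g => by
    change C.presheaf.map (homOfLE (ι.preimage_mono V.2)).op (ι.app U a * f) * idealVal g =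
      ι.app V.1 (X.presheaf.map (homOfLE V.2).op a) * (C.presheaf.map _ f * idealVal g)
    rw [map_mul, mul_assoc]
    congr 1
    exact congr($(ι.naturality (homOfLE V.2).op) a).symm

lemma mulSection_res (I : C.IdealSheafData) {U V : X.Opens} (h : V ≤ U) (f : Γ(C, ι ⁻¹ᵁ U)) :
    mulSection ι I V (C.presheaf.map (homOfLE (ι.preimage_mono h)).op f) =
      homRes _ _ h (mulSection ι I U f) :=
  Subtype.ext <| funext fun W => LinearMap.ext fun g => by
    change C.presheaf.map (homOfLE (ι.preimage_mono W.2)).op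
      (C.presheaf.map (homOfLE (ι.preimage_mono h)).op f) * idealVal g =
      C.presheaf.map (homOfLE (ι.preimage_mono (W.2.trans h))).op f * idealVal g
    rw [← CategoryTheory.comp_apply, ← Functor.map_comp]
    rfl

/-- The canonical map `𝒪_C ⟶ ℋom(I, 𝒪_C)`, sending `1` to the inclusion `I ⊆ 𝒪_C`. -/
def mulHom (I : C.IdealSheafData) : curveSheaf ι ⟶ idealDual ι I :=
  mkHom
    (fun U =>
      { toFun := mulSection ι I U
        map_add' := mulSection_add ι I U
        map_smul' := mulSection_smul ι I U })
    (fun _ _ h f => mulSection_res ι I h f)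

/-- The sheaf `ℋom(I, 𝒪_C)/𝒪_C` on `X`. -/
abbrev dualQuotient (I : C.IdealSheafData) : X.Modules := cokernel (mulHom ι I)

lemma mulHom_precomp {I J : C.IdealSheafData} (h : J ≤ I) :
    mulHom ι I ≫ sheafHomPrecomp _ ((Scheme.Modules.pushforward ι).map (idealInclusion h)) =
      mulHom ι J :=
  Scheme.Modules.hom_ext _ _ fun _ => ConcreteCategory.hom_ext _ _ fun _ =>
    Subtype.ext <| funext fun _ => LinearMap.ext fun _ => rfl

/-- For `J ⊆ I`, the map `ℋom(I, 𝒪_C)/𝒪_C ⟶ ℋom(J, 𝒪_C)/𝒪_C` given by restricting homomorphisms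
to `J`. -/
def dualQuotientMap {I J : C.IdealSheafData} (h : J ≤ I) : dualQuotient ι I ⟶ dualQuotient ι J :=
  cokernel.map _ _ (𝟙 _)
    (sheafHomPrecomp _ ((Scheme.Modules.pushforward ι).map (idealInclusion h)))
    (by rw [mulHom_precomp, Category.id_comp])

lemma pow_anti (m : C.IdealSheafData) {r r' : ℕ} (h : r ≤ r') : m ^ r' ≤ m ^ r :=
  fun U => Ideal.pow_le_pow_right (I := m.ideal U) h

/-- The transition map `ℋom(𝔪^r, 𝒪_C)/𝒪_C ⟶ ℋom(𝔪^r', 𝒪_C)/𝒪_C` for `r ≤ r'`. -/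
abbrev transition (m : C.IdealSheafData) {r r' : ℕ} (h : r ≤ r') :
    dualQuotient ι (m ^ r) ⟶ dualQuotient ι (m ^ r') :=
  dualQuotientMap ι (pow_anti m h)

end

/-! ### Cohen–Macaulay curves -/

/-- A Noetherian local ring is Cohen–Macaulay if its maximal ideal contains a regular sequence
whose length is the Krull dimension of the ring. -/
def IsCohenMacaulayLocal (R : Type u) [CommRing R] [IsLocalRing R] : Prop :=
  IsNoetherianRing R ∧ ∃ rs : List R, RingTheory.Sequence.IsRegular R rs ∧
    (∀ r ∈ rs, r ∈ IsLocalRing.maximalIdeal R) ∧ (rs.length : WithBot ℕ∞) = ringKrullDim R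

/-- A Cohen–Macaulay curve: a nonempty scheme with Cohen–Macaulay local rings, all of whose
irreducible components have dimension one. -/
structure IsCohenMacaulayCurve (C : Scheme.{u}) : Prop where
  nonempty : Nonempty C
  isCohenMacaulayLocal (x : C) : IsCohenMacaulayLocal (C.presheaf.stalk x)
  dim_component (Z : Set C) (hZ : Z ∈ irreducibleComponents C) : topologicalKrullDim Z = 1

/-! ### Stable pairs -/

section

variable {X C : Scheme.{u}}

/-- On a locally Noetherian scheme a sheaf of modules is coherent if and only if it is
quasi-coherent and of finite type. -/
def IsCoherent (F : X.Modules) : Prop := F.IsQuasicoherent ∧ F.IsFiniteType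

/-- The set-theoretic support: the set of points at which the stalk is nonzero. -/
def support (F : X.Modules) : Set X := {x | Nontrivial (F.presheaf.stalk x)}

/-- `F` is pure of dimension one: every nonzero coherent subsheaf has one-dimensional support. -/
def IsPure (F : X.Modules) : Prop :=
  ∀ (G : X.Modules) (i : G ⟶ F), Mono i → IsCoherent G → ¬ IsZero G →
    topologicalKrullDim (support G) = 1

variable (X) in
/-- A sheaf `F` on `X` with a section `s : 𝒪_X ⟶ F`. -/
structure SheafPair where
  /-- the sheaf -/
  F : X.Modules
  /-- the section -/
  s : structureSheaf X ⟶ F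

namespace SheafPair

/-- An isomorphism of pairs is an isomorphism of sheaves compatible with the sections. -/
def Isomorphic (P P' : SheafPair X) : Prop := ∃ e : P.F ≅ P'.F, P.s ≫ e.hom = P'.s

/-- The cokernel of the section. -/
abbrev coker (P : SheafPair X) : X.Modules := cokernel P.s

/-- Stable pairs: `F` is coherent and pure of dimension one, and the cokernel of the section has
support of dimension (at most) zero. -/
structure IsStable (P : SheafPair X) : Prop where
  coherent : IsCoherent P.F
  pure : IsPure P.F
  dim_coker : topologicalKrullDim (support P.coker) ≤ 0

/-- The scheme-theoretic support of `F` is the closed subscheme `ι : C ⟶ X`: the annihilator ideal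
of `F` is the ideal sheaf of `C`. -/
def HasSupport (P : SheafPair X) (ι : C ⟶ X) : Prop :=
  ∀ U : X.affineOpens, Module.annihilator Γ(X, U.1) Γ(P.F, U.1) = ι.ker.ideal U

/-- Stable pairs with scheme-theoretic support `C` whose cokernel is supported in
`Supp(𝒪_C/𝔪)`. -/
structure IsStableOn (P : SheafPair X) (ι : C ⟶ X) (m : C.IdealSheafData) : Prop where
  stable : P.IsStable
  hasSupport : P.HasSupport ι
  support_coker : support P.coker ⊆ ι '' (m.support : Set C)

end SheafPair

variable (ι : C ⟶ X) {I : C.IdealSheafData}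

/-- The inverse image in `ℋom(I, 𝒪_C)` of a subsheaf `Q` of `ℋom(I, 𝒪_C)/𝒪_C`. -/
abbrev inverseImage (Q : Subobject (dualQuotient ι I)) : X.Modules :=
  pullback Q.arrow (cokernel.π (mulHom ι I))

/-- The map from `𝒪_C` to the inverse image of `Q` induced by `𝒪_C ⟶ ℋom(I, 𝒪_C)`. -/
abbrev toInverseImage (Q : Subobject (dualQuotient ι I)) : curveSheaf ι ⟶ inverseImage ι Q :=
  pullback.lift 0 (mulHom ι I) (by simp)

/-- The pair attached to a subsheaf `Q ⊆ ℋom(I, 𝒪_C)/𝒪_C`: the inverse image `F` of `Q` in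
`ℋom(I, 𝒪_C)`, with the section `𝒪_X ⟶ 𝒪_C ⟶ F`. -/
def subsheafPair (Q : Subobject (dualQuotient ι I)) : SheafPair X where
  F := inverseImage ι Q
  s := curveSection ι ≫ toInverseImage ι Q

/-- The sequence `0 ⟶ 𝒪_C ⟶ F ⟶ Q ⟶ 0`, where `F` is the inverse image of `Q`. -/
def subsheafSequence (Q : Subobject (dualQuotient ι I)) : ShortComplex X.Modules :=
  ShortComplex.mk (toInverseImage ι Q) (pullback.fst Q.arrow (cokernel.π (mulHom ι I)))
    (pullback.lift_fst _ _ _)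

end

end

end StablePairs

/-! Everything rests on two facts. The first concerns $C$: a Cohen–Macaulay curve has no embedded
points, so a function on an open subset of $C$ that vanishes near all generic points is zero
(`IsCohenMacaulayCurve.eq_zero`). The zero locus of $\mathfrak m$ has dimension $\le 0$ and so
misses the generic points. Off that locus $\mathfrak m^r$ locally contains a unit, so a function
killed by $\mathfrak m^r$ is zero (`eq_zero_of_mul_pow`). Hence $\mathcal O_C\to\mathcal
Hom(\mathfrak m^r,\mathcal O_C)$ and the restriction maps between different $r$ are injective. The
second fact is the identity $g\varphi=\varphi(g)$ in $\mathcal Hom(I,\mathcal O_C)$ for $g\in I$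
(`smul_dual`): both sides send $g'$ to $\varphi(gg')$. So $I$ kills $\mathcal Hom(I,\mathcal
O_C)/\mathcal O_C$, and the quotient vanishes wherever $I$ contains a unit.

From $Q$ to a pair: $F_Q$ is an extension of $Q$ by $\mathcal O_C$, hence coherent, and by the
second fact the cokernel of its section lives on the zero locus of $\mathfrak m$. It is pure because
a nonzero homomorphism takes a nonzero value in $\mathcal O_C$, which survives at some generic point
(`isPure_inverseImage`). Its annihilator is the ideal of $C$ because $\mathcal O_C\subset F_Q$. An
isomorphism of pairs fixes $\mathcal O_C$; since $gy\in\mathcal O_C$ for $y\in F_Q$ and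
$g\in\mathfrak m^r$, it must respect the inclusions into $\mathcal Hom(\mathfrak m^r,\mathcal O_C)$,
so $Q$ is recovered (`comp_inverseImageι`).

From a pair to $Q$: the section factors through $t\colon\mathcal O_C\to F$, which is injective
because $F$ has full annihilator ideal (`mono_of_support_cokernel_subset`). The coherent sheaf
$F/\mathcal O_C$ is supported on the zero locus of $\mathfrak m$, so by quasi-compactness of $X$ it
is killed by $\mathfrak m^r$ for $r\gg0$. Then $x\mapsto(g\mapsto gx)$ maps $F$ to $\mathcal
Hom(\mathfrak m^r,\mathcal O_C)$. Its kernel is a coherent subsheaf with support of dimension $\le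
0$, zero by purity (`mono_of_isPure`). Thus $F$ lies between $\mathcal O_C$ and $\mathcal
Hom(\mathfrak m^r,\mathcal O_C)$, and is the inverse image of its image in the quotient
(`exists_iso_inverseImage`).

Coherence is handled on affine opens through `LocalizingAt` and finiteness of sections;
`isCoherent_of_locally`, `localizingAt_of_isQuasicoherent` and `finite_of_isCoherent` are the bridge
to the sheaf-theoretic definition. -/

namespace StablePairs

noncomputable section

/-! ### Sections, restriction and gluing -/

section Sections

variable {X : Scheme.{u}}

/-- Restriction of functions to a smaller open set. -/
def resR {U V : X.Opens} (h : V ≤ U) : Γ(X, U) →+* Γ(X, V) :=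
  (X.presheaf.map (homOfLE h).op).hom

/-- Restriction of sections of a sheaf of modules to a smaller open set. -/
def res (M : X.Modules) {U V : X.Opens} (h : V ≤ U) : Γ(M, U) →+ Γ(M, V) :=
  (M.presheaf.map (homOfLE h).op).hom

lemma resR_self {U : X.Opens} (a : Γ(X, U)) : resR (le_refl U) a = a := by
  change X.presheaf.map (𝟙 _) a = a
  simp

lemma resR_resR {U V W : X.Opens} (h : V ≤ U) (h' : W ≤ V) (a : Γ(X, U)) :
    resR h' (resR h a) = resR (h'.trans h) a := by
  change (X.presheaf.map _) (X.presheaf.map _ a) = _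
  rw [← CategoryTheory.comp_apply, ← Functor.map_comp]
  rfl

variable (M : X.Modules)

lemma res_self {U : X.Opens} (x : Γ(M, U)) : res M (le_refl U) x = x := by
  change M.presheaf.map (𝟙 _) x = x
  simp

lemma res_res {U V W : X.Opens} (h : V ≤ U) (h' : W ≤ V) (x : Γ(M, U)) :
    res M h' (res M h x) = res M (h'.trans h) x := by
  change (M.presheaf.map _) (M.presheaf.map _ x) = _
  rw [← CategoryTheory.comp_apply, ← Functor.map_comp]
  rfl

lemma res_smul {U V : X.Opens} (h : V ≤ U) (a : Γ(X, U)) (x : Γ(M, U)) :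
    res M h (a • x) = resR h a • res M h x :=
  M.map_smul (homOfLE h) a x

variable {M}

lemma app_res {N : X.Modules} (f : M ⟶ N) {U V : X.Opens} (h : V ≤ U) (x : Γ(M, U)) :
    f.app V (res M h x) = res N h (f.app U x) :=
  congr($(f.mapPresheaf.naturality (homOfLE h).op) x)

lemma app_smul' {N : X.Modules} (f : M ⟶ N) {U : X.Opens} (a : Γ(X, U)) (x : Γ(M, U)) :
    f.app U (a • x) = a • f.app U x :=
  f.app_smul a x

lemma section_ext {U : X.Opens} {x y : Γ(M, U)}
    (h : ∀ p ∈ U, ∃ (V : X.Opens) (hV : V ≤ U), p ∈ V ∧ res M hV x = res M hV y) : x = y := by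
  choose V hV hp hxy using h
  exact TopCat.Sheaf.eq_of_locally_eq' ⟨M.presheaf, M.isSheaf⟩
    (fun p : U => V p.1 p.2) U (fun p => homOfLE (hV p.1 p.2))
    (fun p hp' => Opens.mem_iSup.2 ⟨⟨p, hp'⟩, hp p hp'⟩) _ _ fun p => hxy p.1 p.2

lemma section_ext_cover {I : Type*} {U : X.Opens} (V : I → X.Opens) (hV : ∀ i, V i ≤ U)
    (hc : U ≤ ⨆ i, V i) {x y : Γ(M, U)} (h : ∀ i, res M (hV i) x = res M (hV i) y) : x = y :=
  section_ext fun p hp => by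
    obtain ⟨i, hi⟩ := Opens.mem_iSup.1 (hc hp)
    exact ⟨V i, hV i, hi, h i⟩

lemma exists_glue {I : Type u} {U : X.Opens} (V : I → X.Opens) (hV : ∀ i, V i ≤ U)
    (hc : U ≤ ⨆ i, V i) (s : ∀ i, Γ(M, V i))
    (hs : ∀ i j, res M inf_le_left (s i) = res M (inf_le_right : V i ⊓ V j ≤ V j) (s j)) :
    ∃ x : Γ(M, U), ∀ i, res M (hV i) x = s i :=
  (TopCat.Sheaf.existsUnique_gluing' ⟨M.presheaf, M.isSheaf⟩ V U (fun i => homOfLE (hV i)) hc s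
    hs).exists

lemma hom_ext_sections {N : X.Modules} {f g : M ⟶ N}
    (h : ∀ (U : X.Opens) (x : Γ(M, U)), f.app U x = g.app U x) : f = g :=
  Scheme.Modules.hom_ext _ _ fun U => ConcreteCategory.hom_ext _ _ fun x => h U x

end Sections

/-! ### Monomorphisms, epimorphisms and exactness in terms of sections -/

section MonoEpi

variable {X : Scheme.{u}} {M N K : X.Modules}

instance mono_app (f : M ⟶ N) [Mono f] (U : X.Opens) : Mono (f.app U) := by
  have : Mono ((Scheme.Modules.toPresheaf X).map f) := inferInstance
  exact (NatTrans.mono_iff_mono_app _).1 this (op U)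

lemma app_injective (f : M ⟶ N) [Mono f] (U : X.Opens) : Function.Injective (f.app U) :=
  (AddCommGrpCat.mono_iff_injective _).1 inferInstance

lemma mono_of_injective (f : M ⟶ N) (h : ∀ U, Function.Injective (f.app U)) : Mono f where
  right_cancellation _ _ e := hom_ext_sections fun U x => h U congr(($e).app U x)

lemma mono_of_locally_eq_zero (f : M ⟶ N)
    (h : ∀ (U : X.Opens) (x : Γ(M, U)), f.app U x = 0 → ∀ p ∈ U,
      ∃ (V : X.Opens) (hV : V ≤ U), p ∈ V ∧ res M hV x = 0) : Mono f :=
  mono_of_injective f fun U => (injective_iff_map_eq_zero _).2 fun x hx =>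
    section_ext fun p hp => by simpa using h U x hx p hp

/-- `f` is surjective on sections, locally on `X`. -/
def LocallySurjective (f : M ⟶ N) : Prop :=
  ∀ (U : X.Opens) (y : Γ(N, U)), ∀ p ∈ U, ∃ (V : X.Opens) (hV : V ≤ U), p ∈ V ∧
    ∃ x : Γ(M, V), f.app V x = res N hV y

lemma epi_of_locallySurjective {f : M ⟶ N} (h : LocallySurjective f) : Epi f where
  left_cancellation _ _ e := hom_ext_sections fun U y => section_ext fun p hp => by
    obtain ⟨V, hV, hpV, x, hx⟩ := h U y p hp
    refine ⟨V, hV, hpV, ?_⟩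
    rw [← app_res, ← app_res, ← hx]
    exact congr(($e).app V x)

variable (N) in
/-- A subsheaf of modules, given by its sections. -/
structure SubmoduleSheaf where
  /-- the sections over `U` -/
  sections (U : X.Opens) : Submodule Γ(X, U) Γ(N, U)
  res_mem {U V : X.Opens} (h : V ≤ U) {y : Γ(N, U)} : y ∈ sections U → res N h y ∈ sections V
  mem_of_locally {U : X.Opens} {y : Γ(N, U)} :
    (∀ p ∈ U, ∃ (V : X.Opens) (hV : V ≤ U), p ∈ V ∧ res N hV y ∈ sections V) → y ∈ sections U

namespace SubmoduleSheaf

variable (S : SubmoduleSheaf N)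

/-- The sub-presheaf of modules underlying a subsheaf. -/
def toSubmodule : N.val.Submodule where
  obj U := S.sections U.unop
  map g _ hx := S.res_mem g.unop.le hx

/-- The sheaf of modules underlying a subsheaf. -/
def toModules : X.Modules where
  val := S.toSubmodule.toPresheafOfModules
  isSheaf := by
    change TopCat.Presheaf.IsSheaf (X := X.toTopCat) _
    rw [TopCat.Presheaf.isSheaf_iff_isSheafUniqueGluing]
    intro J U s hs
    change ∀ j, S.sections (U j) at s
    have hs' (i j : J) : res N (inf_le_left : U i ⊓ U j ≤ U i) (s i).1 =
        res N inf_le_right (s j).1 := congr_arg Subtype.val (hs i j)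
    obtain ⟨y, hy⟩ := exists_glue U (le_iSup U) le_rfl (fun j => (s j).1) hs'
    have hmem : y ∈ S.sections (iSup U) := S.mem_of_locally fun p hp => by
      obtain ⟨i, hi⟩ := Opens.mem_iSup.1 hp
      exact ⟨U i, le_iSup U i, hi, by rw [hy]; exact (s i).2⟩
    exact ⟨(⟨y, hmem⟩ : S.sections (iSup U)), fun j => Subtype.ext (hy j),
      fun z hz => Subtype.ext (section_ext_cover U (le_iSup U) le_rfl fun j =>
        (congr_arg Subtype.val (hz j)).trans (hy j).symm)⟩

/-- The inclusion of a subsheaf. -/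
def ι : S.toModules ⟶ N := ⟨S.toSubmodule.ι⟩

instance : Mono S.ι := mono_of_injective _ fun _ => Subtype.val_injective

lemma ι_app_mem {U : X.Opens} (z : Γ(S.toModules, U)) : S.ι.app U z ∈ S.sections U :=
  (show S.sections U from z).2

lemma exists_ι_app {U : X.Opens} {y : Γ(N, U)} (hy : y ∈ S.sections U) :
    ∃ z : Γ(S.toModules, U), S.ι.app U z = y :=
  ⟨(⟨y, hy⟩ : S.sections U), rfl⟩

/-- The factorization of a morphism with values in a subsheaf. -/
def lift (f : M ⟶ N) (h : ∀ (U : X.Opens) (x : Γ(M, U)), f.app U x ∈ S.sections U) :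
    M ⟶ S.toModules :=
  mkHom (N := S.toModules) (fun U => (appLinear f U).codRestrict (S.sections U) (h U))
    (fun _ _ h x => Subtype.ext (app_res f h x))

lemma lift_ι (f : M ⟶ N) (h : ∀ (U : X.Opens) (x : Γ(M, U)), f.app U x ∈ S.sections U) :
    S.lift f h ≫ S.ι = f :=
  hom_ext_sections fun _ _ => rfl

end SubmoduleSheaf

/-- The sections that are locally in the image of `f`. -/
def imageSheaf (f : M ⟶ N) : SubmoduleSheaf N where
  sections U :=
    { carrier := {y | ∀ p ∈ U, ∃ (V : X.Opens) (hV : V ≤ U), p ∈ V ∧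
        ∃ x : Γ(M, V), f.app V x = res N hV y}
      add_mem' {y z} hy hz p hp := by
        obtain ⟨V, hV, hpV, x, hx⟩ := hy p hp
        obtain ⟨W, hW, hpW, x', hx'⟩ := hz p hp
        refine ⟨V ⊓ W, inf_le_left.trans hV, ⟨hpV, hpW⟩,
          res M inf_le_left x + res M inf_le_right x', ?_⟩
        rw [map_add, app_res, app_res, hx, hx', res_res, res_res, map_add]
      zero_mem' p hp := ⟨U, le_rfl, hp, 0, by simp⟩
      smul_mem' a y hy p hp := by
        obtain ⟨V, hV, hpV, x, hx⟩ := hy p hp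
        exact ⟨V, hV, hpV, resR hV a • x, by rw [app_smul', hx, res_smul]⟩ }
  res_mem {U V} h y hy p hp := by
    obtain ⟨W, hW, hpW, x, hx⟩ := hy p (h hp)
    refine ⟨W ⊓ V, inf_le_right, ⟨hpW, hp⟩, res M inf_le_left x, ?_⟩
    rw [app_res, hx, res_res, res_res]
  mem_of_locally {U y} h p hp := by
    obtain ⟨V, hV, hpV, hy⟩ := h p hp
    obtain ⟨W, hW, hpW, x, hx⟩ := hy p hpV
    exact ⟨W, hW.trans hV, hpW, x, by rw [hx, res_res]⟩

/-- The inclusion of the image sheaf is mono, and epi because `f` factors through it; an abelian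
category is balanced, so the inclusion is an isomorphism. -/
lemma locallySurjective_of_epi (f : M ⟶ N) [Epi f] : LocallySurjective f := by
  have hfac := (imageSheaf f).lift_ι f fun U x p hp => ⟨U, le_rfl, hp, x, (res_self N _).symm⟩
  have : Epi (imageSheaf f).ι := epi_of_epi_fac hfac
  have : IsIso (imageSheaf f).ι := isIso_of_mono_of_epi _
  intro U y
  obtain ⟨z, rfl⟩ : ∃ z, (imageSheaf f).ι.app U z = y :=
    ((ConcreteCategory.isIso_iff_bijective _).1
      (inferInstanceAs (IsIso ((imageSheaf f).ι.app U)))).2 y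
  exact (imageSheaf f).ι_app_mem z

/-- The sections killed by `f`. -/
def kernelSheaf (f : M ⟶ N) : SubmoduleSheaf M where
  sections U := LinearMap.ker (appLinear f U)
  res_mem {U V} h y hy := by
    change f.app V (res M h y) = 0
    rw [app_res, show f.app U y = 0 from hy, map_zero]
  mem_of_locally {U y} h := section_ext (M := N) fun p hp => by
    obtain ⟨V, hV, hpV, hy⟩ := h p hp
    refine ⟨V, hV, hpV, ?_⟩
    rw [map_zero]
    exact (app_res f hV y).symm.trans hy

lemma kernelSheaf_condition (f : M ⟶ N) : (kernelSheaf f).ι ≫ f = 0 :=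
  hom_ext_sections fun _ z => (kernelSheaf f).ι_app_mem z

/-- Left exactness of sections: a section killed by the cokernel of a monomorphism comes from a
section of the source. -/
lemma exists_of_exact {f : M ⟶ N} {g : N ⟶ K} [Mono f] {w : f ≫ g = 0}
    (h : (ShortComplex.mk f g w).Exact) {U : X.Opens} {y : Γ(N, U)} (hy : g.app U y = 0) :
    ∃ x, f.app U x = y := by
  obtain ⟨z, hz⟩ := (kernelSheaf g).exists_ι_app (y := y) hy
  refine ⟨(h.lift (kernelSheaf g).ι (kernelSheaf_condition g)).app U z, ?_⟩
  rw [← hz]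
  exact congr(($(h.lift_f (kernelSheaf g).ι (kernelSheaf_condition g))).app U z)

lemma exists_of_cokernel_eq_zero (f : M ⟶ N) [Mono f] {U : X.Opens} {y : Γ(N, U)}
    (hy : (cokernel.π f).app U y = 0) : ∃ x, f.app U x = y :=
  exists_of_exact (ShortComplex.exact_cokernel f) hy

/-- Without `Mono f` a preimage exists only locally. Replacing `f` by the inclusion of its image
sheaf, through whose cokernel the vanishing passes, reduces to left exactness. -/
lemma exists_locally_of_cokernel_eq_zero (f : M ⟶ N) {U : X.Opens} {y : Γ(N, U)}
    (hy : (cokernel.π f).app U y = 0) : ∀ p ∈ U, ∃ (V : X.Opens) (hV : V ≤ U), p ∈ V ∧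
      ∃ x : Γ(M, V), f.app V x = res N hV y := by
  have hfac := (imageSheaf f).lift_ι f fun U x p hp => ⟨U, le_rfl, hp, x, (res_self N _).symm⟩
  have h0 : f ≫ cokernel.π (imageSheaf f).ι = 0 := by
    have h := congr($hfac ≫ cokernel.π (imageSheaf f).ι)
    rw [Category.assoc, cokernel.condition, comp_zero] at h
    exact h.symm
  have hz : (cokernel.π (imageSheaf f).ι).app U y = 0 := by
    rw [← cokernel.π_desc f _ h0]
    change (cokernel.desc f _ _).app U ((cokernel.π f).app U y) = 0
    rw [hy, map_zero]
  obtain ⟨z, rfl⟩ := exists_of_cokernel_eq_zero _ hz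
  exact (imageSheaf f).ι_app_mem z

lemma app_cokernel_π (f : M ⟶ N) {U : X.Opens} (x : Γ(M, U)) :
    (cokernel.π f).app U (f.app U x) = 0 :=
  congr(($(cokernel.condition f)).app U x)

end MonoEpi

/-! ### Localizing sheaves and the comparison with modules on the spectrum -/

section Localizing

variable {X : Scheme.{u}}

/-- The sections of `F` over the basic opens of `U` are the localizations of the sections of `F`
over `U`. -/
structure LocalizingAt (F : X.Modules) (U : X.Opens) : Prop where
  exists_lift (f : Γ(X, U)) (s : Γ(F, X.basicOpen f)) :
    ∃ (n : ℕ) (t : Γ(F, U)), res F (X.basicOpen_le f) t = resR (X.basicOpen_le f) f ^ n • s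
  exists_pow_smul (f : Γ(X, U)) (t : Γ(F, U)) :
    res F (X.basicOpen_le f) t = 0 → ∃ n : ℕ, f ^ n • t = 0

variable {U : X.Opens} (hU : IsAffineOpen U) (F : X.Modules)

lemma fromSpec_image_le (V : (Spec Γ(X, U)).Opens) : hU.fromSpec ''ᵁ V ≤ U := by
  conv_rhs => rw [← hU.opensRange_fromSpec]
  exact Scheme.Hom.image_le_opensRange _ _

lemma fromSpec_image_top : hU.fromSpec ''ᵁ ⊤ = U := by
  rw [Scheme.Hom.image_top_eq_opensRange, hU.opensRange_fromSpec]

lemma fromSpec_appIso_inv (V : (Spec Γ(X, U)).Opens) (r : Γ(X, U)) :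
    (hU.fromSpec.appIso V).inv
      ((Spec Γ(X, U)).presheaf.map V.leTop.op ((Scheme.ΓSpecIso Γ(X, U)).inv r)) =
    resR (fromSpec_image_le hU V) r := by
  have h : (Scheme.ΓSpecIso Γ(X, U)).inv ≫ (Spec Γ(X, U)).presheaf.map V.leTop.op =
      hU.fromSpec.appLE U V (by rw [hU.fromSpec_preimage_self]; exact le_top) := by
    rw [Scheme.Hom.appLE, hU.fromSpec_app_self, Category.assoc, ← Functor.map_comp]
    rfl
  have h2 := congr($h ≫ (hU.fromSpec.appIso V).inv)
  rw [Scheme.Hom.appLE_appIso_inv] at h2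
  exact congr($h2 r)

/-- Sections of the restriction of `F` to the spectrum of `Γ(X, U)`. -/
def specSections {V : (Spec Γ(X, U)).Opens} {W : X.Opens} (h : hU.fromSpec ''ᵁ V = W) :
    Γ(F.restrict hU.fromSpec, V) ≃+ Γ(F, W) where
  toFun x := res F h.ge (show Γ(F, hU.fromSpec ''ᵁ V) from x)
  invFun y := res F h.le y
  left_inv x := by
    change res F h.le (res F h.ge _) = _
    rw [res_res, res_self]
  right_inv y := by
    change res F h.ge (res F h.le _) = _
    rw [res_res, res_self]
  map_add' x y := map_add (res F h.ge) _ _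

lemma specSections_smul {V : (Spec Γ(X, U)).Opens} {W : X.Opens} (h : hU.fromSpec ''ᵁ V = W)
    (hW : W ≤ U) (r : Γ(X, U)) (x : Γ(F.restrict hU.fromSpec, V)) :
    specSections hU F h (r • x) = resR hW r • specSections hU F h x := by
  have h1 : r • x = (show Γ(F.restrict hU.fromSpec, V) from
      (resR (fromSpec_image_le hU V) r • (show Γ(F, hU.fromSpec ''ᵁ V) from x) :)) := by
    rw [← fromSpec_appIso_inv, Scheme.Modules.smul_Spec_def]
    rfl
  rw [h1]
  change res F h.ge (resR _ r • _) = _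
  rw [res_smul, resR_resR]
  rfl

lemma specSections_res {V V' : (Spec Γ(X, U)).Opens} {W W' : X.Opens}
    (h : hU.fromSpec ''ᵁ V = W) (h' : hU.fromSpec ''ᵁ V' = W') (hV : V' ≤ V) (hW : W' ≤ W)
    (x : Γ(F.restrict hU.fromSpec, V)) :
    specSections hU F h' (res _ hV x) = res F hW (specSections hU F h x) := by
  exact (res_res F _ _ _).trans (res_res F _ _ _).symm

/-- Both sides say that $F(D(f))$ is $F(U)$ with $f$ inverted. Invertibility of $f$ on $F(D(f))$ is
automatic, so `LocalizingAt` records only the other two conditions of a localization. -/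
lemma isLocalizing_restrict_iff :
    IsLocalizing (modulesSpecToSheaf.obj (F.restrict hU.fromSpec)) ↔ LocalizingAt F U := by
  let φ (f : Γ(X, U)) := ((modulesSpecToSheaf.obj (F.restrict hU.fromSpec)).obj.map
    (PrimeSpectrum.basicOpen f).leTop.op).hom
  let D (f : Γ(X, U)) : (Spec Γ(X, U)).Opens := PrimeSpectrum.basicOpen f
  let e₁ := specSections hU F (fromSpec_image_top hU)
  let e (f : Γ(X, U)) : Γ(F.restrict hU.fromSpec, D f) ≃+ Γ(F, X.basicOpen f) :=
    specSections hU F (hU.fromSpec_image_basicOpen f)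
  have hφ (f : Γ(X, U)) (x) : e f (φ f x) = res F (X.basicOpen_le f) (e₁ x) :=
    specSections_res hU F _ _ le_top _ x
  have he₁ (n : ℕ) (f : Γ(X, U)) (x) : e₁ (f ^ n • x) = f ^ n • e₁ x := by
    have := specSections_smul hU F (fromSpec_image_top hU) le_rfl (f ^ n) x
    rwa [resR_self] at this
  have he (n : ℕ) (f : Γ(X, U)) (x : Γ(F.restrict hU.fromSpec, D f)) :
      e f (f ^ n • x) = resR (X.basicOpen_le f) f ^ n • e f x := by
    rw [← map_pow]
    exact specSections_smul hU F (hU.fromSpec_image_basicOpen f) (X.basicOpen_le f) (f ^ n) x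
  refine ⟨fun h => ⟨fun f s => ?_, fun f t ht => ?_⟩,
    fun h f => IsLocalizedModule.Away.mk_of_addCommGroup ?_ ?_ ?_⟩
  · have hf : IsLocalizedModule.Away f (φ f) := h f
    obtain ⟨n, y, hy⟩ := hf.surj _ _ ((e f).symm s)
    refine ⟨n, e₁ y, ?_⟩
    refine (hφ f y).symm.trans ((congr_arg (e f) hy.symm).trans ?_)
    exact (he n f _).trans (by rw [(e f).apply_symm_apply])
  · have hf : IsLocalizedModule.Away f (φ f) := h f
    have h0 : φ f (e₁.symm t) = 0 := by
      apply (e f).injective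
      refine (hφ f _).trans (Eq.trans ?_ (map_zero (e f)).symm)
      rw [e₁.apply_symm_apply, ht]
    obtain ⟨⟨_, n, rfl⟩, hn⟩ := (IsLocalizedModule.eq_zero_iff (.powers f) (φ f)).mp h0
    refine ⟨n, ?_⟩
    have h2 := he₁ n f (e₁.symm t)
    rw [e₁.apply_symm_apply] at h2
    rw [← h2]
    exact (congr_arg e₁ hn).trans (map_zero _)
  · exact Scheme.Modules.isUnit_algebraMap_end_of_le_basicOpen f le_rfl
  · intro x
    obtain ⟨n, t, ht⟩ := h.exists_lift f (e f x)
    refine ⟨n, e₁.symm t, (e f).injective ((he n f x).trans (ht.symm.trans ?_))⟩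
    exact ((hφ f _).trans (by rw [e₁.apply_symm_apply])).symm
  · intro x hx
    obtain ⟨n, hn⟩ := h.exists_pow_smul f (e₁ x)
      ((hφ f x).symm.trans ((congr_arg (e f) hx).trans (map_zero _)))
    exact ⟨n, e₁.injective ((he₁ n f x).trans (hn.trans (map_zero _).symm))⟩

lemma isIso_fromTildeΓ_restrict_iff :
    IsIso (F.restrict hU.fromSpec).fromTildeΓ ↔ LocalizingAt F U := by
  rw [isIso_fromTildeΓ_iff_isLocalizing, isLocalizing_restrict_iff]

lemma localizingAt_of_isQuasicoherent (hF : F.IsQuasicoherent) {U : X.Opens}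
    (hU : IsAffineOpen U) : LocalizingAt F U :=
  (isIso_fromTildeΓ_restrict_iff hU F).1 inferInstance

lemma finite_iff_finite_restrict :
    Module.Finite Γ(X, U) Γ(F, U) ↔ Module.Finite Γ(X, U) Γ(F.restrict hU.fromSpec, ⊤) := by
  let e : Γ(F.restrict hU.fromSpec, ⊤) ≃ₗ[Γ(X, U)] Γ(F, U) :=
    { specSections hU F (fromSpec_image_top hU) with
      map_smul' := fun r x => by
        have := specSections_smul hU F (fromSpec_image_top hU) le_rfl r x
        rwa [resR_self] at this }
  exact (Module.Finite.equiv_iff e).symm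

end Localizing

/-! ### Cokernels of localizing sheaves -/

section Cokernel

/-- Up to the counit isomorphisms `p` is the tilde of its map on global sections, and tilde reflects
epimorphisms. -/
lemma surjective_app_top_of_epi {R : CommRingCat.{u}} {M N : (Spec R).Modules} (p : M ⟶ N)
    [Epi p] [IsIso M.fromTildeΓ] [IsIso N.fromTildeΓ] : Function.Surjective (p.app ⊤) := by
  let q := (moduleSpecΓFunctor (R := R)).map p
  have h : (tilde.functor R).map q ≫ N.fromTildeΓ = M.fromTildeΓ ≫ p :=
    (tilde.adjunction (R := R)).counit.naturality p
  have h1 : Epi ((tilde.functor R).map q ≫ N.fromTildeΓ) := by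
    rw [h]
    exact epi_comp (C := (Spec R).Modules) M.fromTildeΓ p
  have h2 : Epi ((tilde.functor R).map q) :=
    (@epi_comp_iff_of_isIso _ _ _ _ _ _ _ (inferInstanceAs (IsIso N.fromTildeΓ))).1 h1
  have h3 : Epi q := (tilde.functor R).epi_of_epi_map h2
  exact (ModuleCat.epi_iff_surjective q).1 h3

variable {X : Scheme.{u}} {K F : X.Modules} {U : X.Opens} (hU : IsAffineOpen U)

lemma isIso_fromTildeΓ_cokernel {R : CommRingCat.{u}} {M N : (Spec R).Modules} (p : M ⟶ N)
    [IsIso M.fromTildeΓ] [IsIso N.fromTildeΓ] : IsIso (cokernel p).fromTildeΓ := by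
  rw [isIso_fromTildeΓ_iff]
  let eM := asIso M.fromTildeΓ
  let eN := asIso N.fromTildeΓ
  let g := (tilde.functor R).preimage (eM.hom ≫ p ≫ eN.inv)
  refine ⟨cokernel g, ⟨PreservesCokernel.iso (tilde.functor R) g ≪≫
    cokernel.mapIso _ _ eM eN ?_⟩⟩
  rw [Functor.map_preimage]
  change (eM.hom ≫ p ≫ eN.inv) ≫ eN.hom = eM.hom ≫ p
  rw [Category.assoc, Category.assoc, Iso.inv_hom_id, Category.comp_id]

-- Restriction to the spectrum of $\Gamma(X,U)$ preserves cokernels and epimorphisms, and there the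
-- cokernel is the tilde of a cokernel of modules.
include hU in
lemma localizingAt_cokernel (f : K ⟶ F) (hK : LocalizingAt K U) (hF : LocalizingAt F U) :
    LocalizingAt (cokernel f) U ∧ Function.Surjective ((cokernel.π f).app U) := by
  let r := Scheme.Modules.restrictFunctor hU.fromSpec
  have : IsIso (r.obj K).fromTildeΓ := (isIso_fromTildeΓ_restrict_iff hU K).2 hK
  have : IsIso (r.obj F).fromTildeΓ := (isIso_fromTildeΓ_restrict_iff hU F).2 hF
  have h1 : IsIso (cokernel (r.map f)).fromTildeΓ := isIso_fromTildeΓ_cokernel _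
  have h2 : IsIso (r.obj (cokernel f)).fromTildeΓ := by
    rw [isIso_fromTildeΓ_iff] at h1 ⊢
    exact (tilde.functor _).essImage.prop_of_iso (PreservesCokernel.iso r f).symm h1
  refine ⟨(isIso_fromTildeΓ_restrict_iff hU _).1 h2, fun y => ?_⟩
  have h3 : Epi (r.map (cokernel.π f)) := inferInstance
  obtain ⟨x, hx⟩ := surjective_app_top_of_epi (r.map (cokernel.π f))
    ((specSections hU _ (fromSpec_image_top hU)).symm y)
  refine ⟨specSections hU _ (fromSpec_image_top hU) x, ?_⟩
  have h4 : (cokernel.π f).app U (specSections hU _ (fromSpec_image_top hU) x) =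
      specSections hU _ (fromSpec_image_top hU) ((r.map (cokernel.π f)).app ⊤ x) :=
    app_res (cokernel.π f) (fromSpec_image_top hU).ge _
  rw [h4, hx, AddEquiv.apply_symm_apply]

end Cokernel

/-! ### Coherent sheaves -/

section Coherent

variable {X : Scheme.{u}}

lemma finite_of_generatingSections {R : CommRingCat.{u}} {M : (Spec R).Modules}
    [IsIso M.fromTildeΓ] (σ : M.GeneratingSections) [σ.IsFiniteType] :
    Module.Finite R Γ(M, ⊤) := by
  have : Finite σ.I := SheafOfModules.GeneratingSections.IsFiniteType.finite
  let N : (Spec R).Modules := SheafOfModules.free σ.I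
  let e : tilde (ModuleCat.of R (σ.I →₀ R)) ≅ N := tildeFinsupp (R := R) σ.I
  let p : N ⟶ M := σ.π
  have : Epi p := σ.epi
  let q : tilde (ModuleCat.of R (σ.I →₀ R)) ⟶ M := e.hom ≫ p
  have : Epi q := epi_comp e.hom p
  have : IsIso (tilde (ModuleCat.of R (σ.I →₀ R))).fromTildeΓ := by
    rw [isIso_fromTildeΓ_iff]; exact ⟨_, ⟨Iso.refl _⟩⟩
  have h := surjective_app_top_of_epi q
  let q' : (moduleSpecΓFunctor (R := R)).obj (tilde (ModuleCat.of R (σ.I →₀ R))) ⟶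
    (moduleSpecΓFunctor (R := R)).obj M := (moduleSpecΓFunctor (R := R)).map q
  let p' : ModuleCat.of R (σ.I →₀ R) ⟶ (moduleSpecΓFunctor (R := R)).obj M :=
    (tilde.isoTop _).hom ≫ q'
  have hp : Function.Surjective p'.hom :=
    h.comp (ConcreteCategory.bijective_of_isIso (tilde.isoTop (ModuleCat.of R (σ.I →₀ R))).hom).2
  exact Module.Finite.of_surjective (M := (σ.I →₀ R)) p'.hom hp

end Coherent

/-! ### Generators and presentations on affine opens -/

section Presentations

variable {X : Scheme.{u}}

/-- An isomorphism of `𝒪_X`-modules, in the category of sheaves of modules. -/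
def sheafOfModulesIso {M N : X.Modules} (e : M ≅ N) :
    @Iso (SheafOfModules.{u} X.ringCatSheaf) _ M N :=
  ⟨e.hom, e.inv, e.hom_inv_id, e.inv_hom_id⟩

/-- Transport of generating sections along an isomorphism. -/
def generatingSectionsOfIso {S : Scheme.{u}} {M N : SheafOfModules.{u} S.ringCatSheaf} (e : M ≅ N)
    (σ : M.GeneratingSections) : N.GeneratingSections :=
  σ.ofEpi e.hom

/-- Transport of a presentation along an isomorphism. -/
def presentationOfIso {S : Scheme.{u}} {M N : SheafOfModules.{u} S.ringCatSheaf} (e : M ≅ N)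
    (σ : M.Presentation) : N.Presentation :=
  σ.ofIsIso e.hom

/-- Restriction of sheaves on the slice over `V` along an open immersion into `V`. -/
def overRestrict {S : Scheme.{u}} {V : X.Opens} (u : S ⟶ V) [IsOpenImmersion u] :
    SheafOfModules.{u} (X.ringCatSheaf.over V) ⥤ SheafOfModules.{u} S.ringCatSheaf :=
  (Scheme.Modules.overEquiv V).functor ⋙ Scheme.Modules.restrictFunctor u

instance {S : Scheme.{u}} {V : X.Opens} (u : S ⟶ V) [IsOpenImmersion u] :
    PreservesColimitsOfSize.{u, u} (overRestrict u) :=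
  have h1 : PreservesColimitsOfSize.{u, u} (Scheme.Modules.restrictFunctor u) := inferInstance
  have h2 : PreservesColimitsOfSize.{u, u} (Scheme.Modules.overEquiv V).functor := inferInstance
  @comp_preservesColimits _ _ _ _ _ _ _ _ h2 h1

/-- The restriction of `F.over V` is the restriction of `F`. -/
def overRestrictIso {S : Scheme.{u}} {V : X.Opens} (u : S ⟶ V) [IsOpenImmersion u]
    (j : S ⟶ X) [IsOpenImmersion j] (h : u ≫ V.ι = j) :
    SheafOfModules.overFunctor X.ringCatSheaf V ⋙ (Scheme.Modules.overEquiv V).functor ⋙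
      Scheme.Modules.restrictFunctor u ≅ Scheme.Modules.restrictFunctor j :=
  Functor.isoWhiskerRight (Scheme.Modules.overFunctorEquiv V) (Scheme.Modules.restrictFunctor u) ≪≫
    (Scheme.Modules.restrictFunctorComp u V.ι).symm ≪≫ Scheme.Modules.restrictFunctorCongr h

/-- Restriction of generating sections to an open subscheme. -/
def generatingSectionsRestrict {S : Scheme.{u}} {V : X.Opens} (F : X.Modules)
    (σ : (SheafOfModules.over F V).GeneratingSections) (u : S ⟶ V) [IsOpenImmersion u]
    (j : S ⟶ X) [IsOpenImmersion j] (h : u ≫ V.ι = j) :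
    SheafOfModules.GeneratingSections (R := S.ringCatSheaf) (F.restrict j) :=
  generatingSectionsOfIso (sheafOfModulesIso ((overRestrictIso u j h).app F))
    (σ.map (overRestrict u) (sheafOfModulesIso (Scheme.Modules.restrictUnitIso u).symm))

/-- A quasi-coherent sheaf on an affine scheme has the presentation defined by generators and
relations of its global sections. -/
def presentationOfTilde {R : CommRingCat.{u}} (M : (Spec R).Modules) [IsIso M.fromTildeΓ]
    (s : Set Γ(M, ⊤)) (hs : Submodule.span R s = ⊤) (t : Set (s →₀ R))
    (ht : Submodule.span R t = LinearMap.ker (Finsupp.linearCombination R ((↑) : s → Γ(M, ⊤)))) :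
    SheafOfModules.Presentation (R := (Spec R).ringCatSheaf) M :=
  presentationOfIso (sheafOfModulesIso (asIso M.fromTildeΓ))
    (presentationTilde ((moduleSpecΓFunctor (R := R)).obj M) s hs t ht)

/-- The equivalence between sheaves on `U` and on the slice over `U`. -/
def overInverse (U : X.Opens) :
    SheafOfModules.{u} (U : Scheme.{u}).ringCatSheaf ⥤ SheafOfModules.{u} (X.ringCatSheaf.over U) :=
  (Opens.sheafOfModulesEquivOver U X.ringCatSheaf).inverse

instance (U : X.Opens) : PreservesColimitsOfSize.{u, u} (overInverse U) :=
  inferInstanceAs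
    (PreservesColimitsOfSize.{u, u} (Opens.sheafOfModulesEquivOver U X.ringCatSheaf).inverse)

/-- A presentation on the spectrum of `Γ(X, U)` gives one on the slice over `U`. -/
def presentationOver (F : X.Modules) {U : X.Opens} (hU : IsAffineOpen U)
    (P : SheafOfModules.Presentation (R := (Spec Γ(X, U)).ringCatSheaf)
      (F.restrict hU.fromSpec)) :
    (SheafOfModules.over F U).Presentation :=
  let e := Opens.sheafOfModulesEquivOver U X.ringCatSheaf
  let i : (F.restrict hU.fromSpec).restrict hU.isoSpec.hom ≅
      (Scheme.Modules.overEquiv U).functor.obj (SheafOfModules.over F U) :=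
    ((Scheme.Modules.restrictFunctorComp hU.isoSpec.hom hU.fromSpec).symm ≪≫
      Scheme.Modules.restrictFunctorCongr hU.isoSpec_hom_fromSpec ≪≫
      (Scheme.Modules.overFunctorEquiv U).symm).app F
  (((presentationOfIso (sheafOfModulesIso i)
    (Scheme.Modules.presentationRestrict hU.isoSpec.hom P)).map (overInverse U)
      (U.sheafOfModulesEquivOverInverseUnit X.ringCatSheaf).symm)).ofIsIso
    (e.unitIso.symm.app (SheafOfModules.over F U)).hom

end Presentations

/-! ### Coherent sheaves -/

section Coherent

variable {X : Scheme.{u}}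

instance isNoetherianRing_affine [IsLocallyNoetherian X] {U : X.Opens} [hU : Fact (IsAffineOpen U)] :
    IsNoetherianRing Γ(X, U) :=
  IsLocallyNoetherian.component_noetherian ⟨U, hU.out⟩

lemma isUnit_resR_basicOpen {U : X.Opens} (f : Γ(X, U)) : IsUnit (resR (X.basicOpen_le f) f) :=
  RingedSpace.isUnit_res_basicOpen _ f

lemma eq_zero_of_pow_smul {F : X.Modules} {U W : X.Opens} {f : Γ(X, U)} (h : W ≤ X.basicOpen f)
    {n : ℕ} {x : Γ(F, W)} (hx : resR (h.trans (X.basicOpen_le f)) f ^ n • x = 0) : x = 0 := by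
  have hu : IsUnit (resR (h.trans (X.basicOpen_le f)) f ^ n) := by
    rw [← resR_resR (X.basicOpen_le f) h]
    exact ((isUnit_resR_basicOpen f).map _).pow n
  exact hu.smul_eq_zero.1 hx

lemma exists_lift_function {U : X.Opens} (hU : IsAffineOpen U) (f : Γ(X, U))
    (a : Γ(X, X.basicOpen f)) :
    ∃ (n : ℕ) (b : Γ(X, U)), resR (X.basicOpen_le f) b = resR (X.basicOpen_le f) f ^ n * a := by
  have := hU.isLocalization_basicOpen f
  obtain ⟨n, b, hb⟩ := IsLocalization.Away.surj f a
  exact ⟨n, b, hb.symm.trans (mul_comm _ _)⟩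

lemma exists_finite_presentation {R : CommRingCat.{u}} [IsNoetherianRing R] (M : (Spec R).Modules)
    [IsIso M.fromTildeΓ] (hM : Module.Finite R Γ(M, ⊤)) :
    ∃ P : SheafOfModules.Presentation (R := (Spec R).ringCatSheaf) M,
      Finite P.generators.I ∧ Finite P.relations.I := by
  obtain ⟨s, hs⟩ := hM.fg_top
  obtain ⟨t, ht⟩ := IsNoetherian.noetherian
    (LinearMap.ker (Finsupp.linearCombination R
      (Subtype.val : {x // x ∈ (s : Set Γ(M, ⊤))} → Γ(M, ⊤))))
  exact ⟨presentationOfTilde M s hs t ht, s.finite_toSet, t.finite_toSet⟩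

/-- On each given affine open, $F$ is the tilde of a finite module over a Noetherian ring, hence
finitely presented; these presentations, moved to the slices, are the local data that both halves of
`IsCoherent` ask for. One affine neighbourhood per point suffices. -/
theorem isCoherent_of_locally [IsLocallyNoetherian X] {F : X.Modules}
    (h : ∀ x : X, ∃ U : X.Opens, IsAffineOpen U ∧ x ∈ U ∧ LocalizingAt F U ∧
      Module.Finite Γ(X, U) Γ(F, U)) : IsCoherent F := by
  choose U hU hx hl hf using h
  have h1 (x : X) : ∃ P : (SheafOfModules.over F (U x)).Presentation, P.IsFinite := by
    have : Fact (IsAffineOpen (U x)) := ⟨hU x⟩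
    have : IsIso (F.restrict (hU x).fromSpec).fromTildeΓ :=
      (isIso_fromTildeΓ_restrict_iff (hU x) F).2 (hl x)
    obtain ⟨P, hP, hP'⟩ := exists_finite_presentation (F.restrict (hU x).fromSpec)
      ((finite_iff_finite_restrict (hU x) F).1 (hf x))
    exact ⟨presentationOver F (hU x) P, ⟨⟨hP⟩, ⟨hP'⟩⟩⟩
  choose P hP using h1
  let σ : SheafOfModules.QuasicoherentData (R := X.ringCatSheaf) F :=
    { I := X
      X := U
      coversTop := (Opens.coversTop_iff _ _).2
        (top_le_iff.1 fun x _ => Opens.mem_iSup.2 ⟨x, hx x⟩)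
      presentation := P }
  have hσ' : σ.localGeneratorsData.IsFiniteType :=
    { isFiniteType := fun x => (hP x).isFiniteType_generators }
  exact ⟨{ nonempty_quasicoherentData := ⟨σ⟩ },
    { exists_localGeneratorsData := ⟨σ.localGeneratorsData, hσ'⟩ }⟩

/-- The finitely many local generators live over members of some cover; they are restricted to a
basic open of `U` contained in one of them. -/
lemma exists_basicOpen_finite {F : X.Modules} (hF : IsCoherent F) {U : X.Opens}
    (hU : IsAffineOpen U) {x : X} (hx : x ∈ U) : ∃ f : Γ(X, U), x ∈ X.basicOpen f ∧
      Module.Finite Γ(X, X.basicOpen f) Γ(F, X.basicOpen f) := by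
  obtain ⟨σ, hσ⟩ := hF.2.exists_localGeneratorsData
  have hc := (Opens.coversTop_iff _ _).1 σ.coversTop
  obtain ⟨i, hi⟩ := Opens.mem_iSup.1 (show x ∈ ⨆ i, σ.X i from hc.symm ▸ trivial)
  obtain ⟨f, hf, hxf⟩ := hU.exists_basicOpen_le (V := σ.X i) ⟨x, hi⟩ hx
  refine ⟨f, hxf, ?_⟩
  have hD := hU.basicOpen f
  rw [finite_iff_finite_restrict hD]
  have : IsIso (F.restrict hD.fromSpec).fromTildeΓ :=
    (isIso_fromTildeΓ_restrict_iff hD F).2 (localizingAt_of_isQuasicoherent F hF.1 hD)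
  let τ := generatingSectionsRestrict F (σ.generators i)
    (hD.isoSpec.inv ≫ X.homOfLE hf) hD.fromSpec (by rw [Category.assoc, Scheme.homOfLE_ι]; rfl)
  have : τ.IsFiniteType := ⟨(hσ.isFiniteType i).finite⟩
  exact finite_of_generatingSections τ

/-- Clearing denominators in generators over $D(f)$ gives a finitely generated $N\subset F(U)$ that
absorbs every section after multiplication by a power of $f$. Finitely many such $D(f)$ cover $U$,
and the sum of the corresponding $N$ is $F(U)$. -/
theorem finite_of_isCoherent {F : X.Modules} (hF : IsCoherent F) {U : X.Opens}
    (hU : IsAffineOpen U) : Module.Finite Γ(X, U) Γ(F, U) := by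
  have hl := localizingAt_of_isQuasicoherent F hF.1 hU
  have h1 (x : U) : ∃ (f : Γ(X, U)) (N : Submodule Γ(X, U) Γ(F, U)), x.1 ∈ X.basicOpen f ∧
      N.FG ∧ ∀ y : Γ(F, U), ∃ n : ℕ, f ^ n • y ∈ N := by
    obtain ⟨f, hxf, hfin⟩ := exists_basicOpen_finite hF hU x.2
    obtain ⟨s, hs⟩ := hfin.fg_top
    choose k t ht using fun z => hl.exists_lift f z
    refine ⟨f, Submodule.span _ (t '' s), hxf,
      Submodule.fg_span (s.finite_toSet.image _), fun y => ?_⟩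
    have key (z : Γ(F, X.basicOpen f)) : ∃ (n : ℕ) (w : Γ(F, U)),
        w ∈ Submodule.span Γ(X, U) (t '' s) ∧
        res F (X.basicOpen_le f) w = resR (X.basicOpen_le f) f ^ n • z := by
      have hz : z ∈ Submodule.span Γ(X, X.basicOpen f) (s : Set Γ(F, X.basicOpen f)) :=
        hs ▸ Submodule.mem_top
      induction hz using Submodule.span_induction with
      | mem z hz => exact ⟨k z, t z, Submodule.subset_span ⟨z, hz, rfl⟩, ht z⟩
      | zero => exact ⟨0, 0, zero_mem _, by simp⟩
      | add z z' _ _ h h' =>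
        obtain ⟨n, w, hw, e⟩ := h
        obtain ⟨n', w', hw', e'⟩ := h'
        refine ⟨n + n', f ^ n' • w + f ^ n • w',
          add_mem (Submodule.smul_mem _ _ hw) (Submodule.smul_mem _ _ hw'), ?_⟩
        rw [map_add, res_smul, res_smul, e, e', map_pow, map_pow, smul_smul, smul_smul, smul_add,
          pow_add, mul_comm]
      | smul a z _ h =>
        obtain ⟨n, w, hw, e⟩ := h
        obtain ⟨m, b, hb⟩ := exists_lift_function hU f a
        refine ⟨m + n, b • w, Submodule.smul_mem _ _ hw, ?_⟩
        rw [res_smul, e, hb, smul_smul, smul_smul, pow_add]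
        congr 1
        ring
    obtain ⟨n, w, hw, e⟩ := key (res F (X.basicOpen_le f) y)
    obtain ⟨m, hm⟩ := hl.exists_pow_smul f (f ^ n • y - w) (by
      rw [map_sub, res_smul, e, map_pow, sub_self])
    refine ⟨m + n, ?_⟩
    rw [smul_sub, sub_eq_zero, smul_smul, ← pow_add] at hm
    rw [hm]
    exact Submodule.smul_mem _ _ hw
  choose f N hxf hN hfN using h1
  obtain ⟨T, hT⟩ := hU.isCompact.elim_finite_subcover (fun x : U => (X.basicOpen (f x) : Set X))
    (fun x => (X.basicOpen (f x)).2) (fun x hx => Set.mem_iUnion.2 ⟨⟨x, hx⟩, hxf ⟨x, hx⟩⟩)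
  refine ⟨(⟨(T.sup N : Submodule Γ(X, U) Γ(F, U)), ?_⟩ : ∃ M : Submodule Γ(X, U) Γ(F, U),
    M.FG ∧ M = ⊤).elim fun M hM => hM.2 ▸ hM.1⟩
  refine ⟨Submodule.fg_finset_sup _ _ fun x _ => hN x, top_le_iff.1 fun y _ => ?_⟩
  refine Submodule.mem_of_span_eq_top_of_smul_pow_mem _ (f '' T) ?_ y ?_
  · rw [← hU.self_le_iSup_basicOpen_iff]
    intro x hx
    obtain ⟨z, hz, hxz⟩ := Set.mem_iUnion₂.1 (hT hx)
    exact Opens.mem_iSup.2 ⟨⟨f z, z, hz, rfl⟩, hxz⟩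
  · rintro ⟨_, x, hx, rfl⟩
    obtain ⟨n, hn⟩ := hfN x y
    exact ⟨n, Finset.le_sup (f := N) hx hn⟩

end Coherent

/-! ### Extensions, cokernels and supports of coherent sheaves -/

section Operations

variable {X : Scheme.{u}} {K F Q : X.Modules}

lemma IsCoherent.localizingAt (hF : IsCoherent F) {U : X.Opens} (hU : IsAffineOpen U) :
    LocalizingAt F U :=
  localizingAt_of_isQuasicoherent F hF.1 hU

lemma exists_affine_mem (x : X) : ∃ U : X.Opens, IsAffineOpen U ∧ x ∈ U := by
  obtain ⟨U, hU, hx, -⟩ := exists_isAffineOpen_mem_and_subset (x := x) (U := ⊤) trivial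
  exact ⟨U, hU, hx⟩

lemma exists_affine_le {x : X} {U : X.Opens} (hx : x ∈ U) :
    ∃ V : X.Opens, IsAffineOpen V ∧ x ∈ V ∧ V ≤ U :=
  exists_isAffineOpen_mem_and_subset hx

theorem isCoherent_cokernel [IsLocallyNoetherian X] (f : K ⟶ F) (hK : IsCoherent K)
    (hF : IsCoherent F) : IsCoherent (cokernel f) :=
  isCoherent_of_locally fun x => by
    obtain ⟨U, hU, hx⟩ := exists_affine_mem x
    obtain ⟨h1, h2⟩ := localizingAt_cokernel hU f (hK.localizingAt hU) (hF.localizingAt hU)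
    have := finite_of_isCoherent hF hU
    exact ⟨U, hU, hx, h1, Module.Finite.of_surjective (appLinear (cokernel.π f) U) h2⟩

theorem isCoherent_of_iso [IsLocallyNoetherian X] (e : K ≅ F) (hK : IsCoherent K) :
    IsCoherent F := by
  have hinj (U : X.Opens) : Function.Injective (e.hom.app U) := app_injective _ _
  have hsurj (U : X.Opens) : Function.Surjective (e.hom.app U) := fun y =>
    ⟨e.inv.app U y, congr(($(e.inv_hom_id)).app U y)⟩
  refine isCoherent_of_locally fun x => ?_
  obtain ⟨U, hU, hx⟩ := exists_affine_mem x
  have := finite_of_isCoherent hK hU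
  refine ⟨U, hU, hx, ⟨fun f s => ?_, fun f t ht => ?_⟩,
    Module.Finite.of_surjective (appLinear e.hom U) (hsurj U)⟩
  · obtain ⟨s, rfl⟩ := hsurj _ s
    obtain ⟨n, t, ht⟩ := (hK.localizingAt hU).exists_lift f s
    exact ⟨n, e.hom.app U t, by rw [← app_res, ht, app_smul']⟩
  · obtain ⟨t, rfl⟩ := hsurj _ t
    obtain ⟨n, hn⟩ := (hK.localizingAt hU).exists_pow_smul f t
      (hinj _ (by rw [app_res, ht, map_zero]))
    exact ⟨n, by rw [← app_smul', hn, map_zero]⟩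

/-- Finitely many sections can be lifted simultaneously on a small basic open. -/
lemma exists_basicOpen_forall {U : X.Opens} (hU : IsAffineOpen U) {x : X} (hx : x ∈ U)
    {I : Type*} (T : Finset I) (p : I → X.Opens → Prop)
    (hp : ∀ i (V W : X.Opens), W ≤ V → p i V → p i W)
    (h : ∀ i ∈ T, ∃ V : X.Opens, x ∈ V ∧ p i V) :
    ∃ f : Γ(X, U), x ∈ X.basicOpen f ∧ ∀ i ∈ T, p i (X.basicOpen f) := by
  classical
  obtain ⟨V, hxV, hV⟩ : ∃ V : X.Opens, x ∈ V ∧ ∀ i ∈ T, p i V := by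
    induction T using Finset.induction_on with
    | empty => exact ⟨U, hx, by simp⟩
    | insert i T _ ih =>
      obtain ⟨V, hxV, hV⟩ := ih fun j hj => h j (Finset.mem_insert_of_mem hj)
      obtain ⟨W, hxW, hW⟩ := h i (Finset.mem_insert_self _ _)
      refine ⟨V ⊓ W, ⟨hxV, hxW⟩, fun j hj => ?_⟩
      rcases Finset.mem_insert.1 hj with rfl | hj
      · exact hp _ _ _ inf_le_right hW
      · exact hp _ _ _ inf_le_left (hV j hj)
  obtain ⟨f, hf, hxf⟩ := hU.exists_basicOpen_le (V := V) ⟨x, hxV⟩ hx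
  exact ⟨f, hxf, fun i hi => hp _ _ _ hf (hV i hi)⟩

/-- If the generators of `Q(U)` lift to `F` on a basic open `D(f)`, then so do all sections of
`Q(D(f))`. -/
lemma surjective_basicOpen {U : X.Opens} (hQ : LocalizingAt Q U) (g : F ⟶ Q)
    {T : Set Γ(Q, U)} (hT : Submodule.span Γ(X, U) T = ⊤) (f : Γ(X, U))
    (h : ∀ t ∈ T, ∃ x : Γ(F, X.basicOpen f), g.app _ x = res Q (X.basicOpen_le f) t) :
    Function.Surjective (g.app (X.basicOpen f)) := by
  have key (t : Γ(Q, U)) :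
      ∃ x : Γ(F, X.basicOpen f), g.app _ x = res Q (X.basicOpen_le f) t := by
    have ht : t ∈ Submodule.span Γ(X, U) T := hT ▸ Submodule.mem_top
    induction ht using Submodule.span_induction with
    | mem t ht => exact h t ht
    | zero => exact ⟨0, by simp⟩
    | add t t' _ _ h h' =>
      obtain ⟨x, hx⟩ := h
      obtain ⟨x', hx'⟩ := h'
      exact ⟨x + x', by rw [map_add, map_add, hx, hx']⟩
    | smul a t _ h =>
      obtain ⟨x, hx⟩ := h
      exact ⟨resR (X.basicOpen_le f) a • x, by rw [app_smul', hx, res_smul]⟩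
  intro y
  obtain ⟨n, t, ht⟩ := hQ.exists_lift f y
  obtain ⟨x, hx⟩ := key t
  obtain ⟨u, hu⟩ := (isUnit_resR_basicOpen f).pow n
  refine ⟨(↑u⁻¹ : Γ(X, X.basicOpen f)) • x, ?_⟩
  rw [app_smul', hx, ht, ← hu, smul_smul, Units.inv_mul, one_smul]

/-- Surjectivity of $F(V)\to Q(V)$ is obtained without cohomology: $Q(U)$ has finitely many
generators, and all of them lift on one small basic open $V$. A diagram chase on $V$ then gives
localization and finiteness for $F$. -/
theorem isCoherent_of_shortExact [IsLocallyNoetherian X] {f : K ⟶ F} {g : F ⟶ Q} {w : f ≫ g = 0}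
    (h : (ShortComplex.mk f g w).ShortExact) (hK : IsCoherent K) (hQ : IsCoherent Q) :
    IsCoherent F := by
  have : Mono f := h.mono_f
  have : Epi g := h.epi_g
  have hw (U : X.Opens) (x : Γ(K, U)) : g.app U (f.app U x) = 0 := congr(($w).app U x)
  refine isCoherent_of_locally fun x => ?_
  obtain ⟨U, hU, hx⟩ := exists_affine_mem x
  obtain ⟨T, hT⟩ := (finite_of_isCoherent hQ hU).fg_top
  obtain ⟨a, hxa, ha⟩ := exists_basicOpen_forall hU hx T
    (fun t V => ∃ (hV : V ≤ U) (y : Γ(F, V)), g.app V y = res Q hV t)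
    (fun t V W hWV => by
      rintro ⟨hV, y, hy⟩
      exact ⟨hWV.trans hV, res F hWV y, by rw [app_res, hy, res_res]⟩)
    (fun t _ => by
      obtain ⟨V, hV, hxV, y, hy⟩ := locallySurjective_of_epi g U t x hx
      exact ⟨V, hxV, hV, y, hy⟩)
  set V := X.basicOpen a
  have hV : IsAffineOpen V := hU.basicOpen a
  have hsurj : Function.Surjective (g.app V) := surjective_basicOpen (hQ.localizingAt hU) g hT a
    fun t ht => (ha t ht).2
  have hKl := hK.localizingAt hV
  have hQl := hQ.localizingAt hV
  refine ⟨V, hV, hxa, ⟨fun b s => ?_, fun b t ht => ?_⟩, ?_⟩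
  · obtain ⟨n, q, hq⟩ := hQl.exists_lift b (g.app _ s)
    obtain ⟨t, rfl⟩ := hsurj q
    -- `t` is right modulo `K`; the error lies in `K` over the basic open and extends to `V` after a
    -- further power of `b`.
    obtain ⟨k, hk⟩ := exists_of_exact h.exact
      (y := resR (X.basicOpen_le b) b ^ n • s - res F (X.basicOpen_le b) t) (by
        rw [map_sub, app_smul', app_res, hq, sub_self])
    obtain ⟨m, k', hk'⟩ := hKl.exists_lift b k
    refine ⟨m + n, b ^ m • t + f.app V k', ?_⟩
    rw [map_add, res_smul, ← app_res, hk', app_smul', hk, map_pow, smul_sub, smul_smul, ← pow_add]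
    abel
  · obtain ⟨n, hn⟩ := hQl.exists_pow_smul b (g.app V t) (by rw [← app_res, ht, map_zero])
    obtain ⟨k, hk⟩ := exists_of_exact h.exact (y := b ^ n • t) (by rw [app_smul', hn])
    obtain ⟨m, hm⟩ := hKl.exists_pow_smul b k (app_injective f _ (by
      rw [app_res, hk, res_smul, ht, smul_zero, map_zero]))
    refine ⟨m + n, ?_⟩
    rw [pow_add, mul_smul, ← hk, ← app_smul', hm, map_zero]
  · have := finite_of_isCoherent hK hV
    have := finite_of_isCoherent hQ hV
    refine Module.Finite.of_exact (f := appLinear f V) (g := appLinear g V) (fun y => ?_) hsurj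
    exact ⟨fun hy => exists_of_exact h.exact hy, by rintro ⟨x, rfl⟩; exact hw V x⟩

lemma notMem_support_iff {x : X} : x ∉ support F ↔ ∀ (U : X.Opens) (s : Γ(F, U)), x ∈ U →
    ∃ (V : X.Opens) (hV : V ≤ U), x ∈ V ∧ res F hV s = 0 := by
  change ¬ Nontrivial _ ↔ _
  rw [not_nontrivial_iff_subsingleton]
  refine ⟨fun h U s hx => ?_, fun h => subsingleton_of_forall_eq 0 fun a => ?_⟩
  · obtain ⟨V, hxV, i, j, e⟩ := TopCat.Presheaf.germ_eq F.presheaf x hx hx s 0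
      (Subsingleton.elim _ _)
    exact ⟨V, i.le, hxV, e.trans (map_zero _)⟩
  · obtain ⟨U, hxU, s, rfl⟩ := TopCat.Presheaf.exists_germ_eq F.presheaf a
    obtain ⟨V, hV, hxV, h0⟩ := h U s hxU
    rw [← map_zero (F.presheaf.germ U x hxU).hom]
    exact TopCat.Presheaf.germ_ext F.presheaf V hxV (homOfLE hV) (homOfLE hV)
      (h0.trans (map_zero (res F hV)).symm)

/-- A coherent sheaf vanishes in a neighbourhood of every point outside of its support. -/
lemma IsCoherent.exists_open_eq_zero [IsLocallyNoetherian X] (hF : IsCoherent F) {x : X}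
    (hx : x ∉ support F) : ∃ V : X.Opens, x ∈ V ∧ ∀ W ≤ V, ∀ s : Γ(F, W), s = 0 := by
  obtain ⟨U, hU, hxU⟩ := exists_affine_mem x
  obtain ⟨T, hT⟩ := (finite_of_isCoherent hF hU).fg_top
  have hl := hF.localizingAt hU
  obtain ⟨a, hxa, ha⟩ := exists_basicOpen_forall hU hxU T
    (fun t V => ∃ hV : V ≤ U, res F hV t = 0)
    (fun t V W hWV => by
      rintro ⟨hV, h0⟩
      exact ⟨hWV.trans hV, by rw [← res_res F hV hWV, h0, map_zero]⟩)
    (fun t _ => by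
      obtain ⟨V, hV, hxV, h0⟩ := notMem_support_iff.1 hx U t hxU
      exact ⟨V, hxV, hV, h0⟩)
  have key (t : Γ(F, U)) : res F (X.basicOpen_le a) t = 0 := by
    have ht : t ∈ Submodule.span Γ(X, U) (T : Set Γ(F, U)) := hT ▸ Submodule.mem_top
    induction ht using Submodule.span_induction with
    | mem t ht => exact (ha t ht).2
    | zero => exact map_zero _
    | add t t' _ _ h h' => rw [map_add, h, h', add_zero]
    | smul a t _ h => rw [res_smul, h, smul_zero]
  refine ⟨X.basicOpen a, hxa, fun W hW s => section_ext fun p hp => ?_⟩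
  obtain ⟨b, hb, hpb⟩ := hU.exists_basicOpen_le (V := W) ⟨p, hp⟩ (X.basicOpen_le a (hW hp))
  refine ⟨X.basicOpen b, hb, hpb, ?_⟩
  obtain ⟨n, t, ht⟩ := hl.exists_lift b (res F hb s)
  rw [map_zero]
  refine eq_zero_of_pow_smul (f := b) (n := n) le_rfl ?_
  rw [← ht, ← res_res F (X.basicOpen_le a) (hb.trans hW), key, map_zero]

lemma IsCoherent.mem_support_of_specializes [IsLocallyNoetherian X] (hF : IsCoherent F) {x y : X}
    (h : x ⤳ y) (hx : x ∈ support F) : y ∈ support F := by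
  by_contra hy
  obtain ⟨V, hyV, hV⟩ := hF.exists_open_eq_zero hy
  refine notMem_support_iff.2 (fun U _ hxU => ?_) hx
  exact ⟨U ⊓ V, inf_le_left, ⟨hxU, h.mem_open V.2 hyV⟩, hV _ inf_le_right _⟩

lemma support_subset_of_mono (f : K ⟶ F) [Mono f] : support K ⊆ support F := fun x hx => by
  by_contra h
  refine notMem_support_iff.2 (fun U s hxU => ?_) hx
  obtain ⟨V, hV, hxV, h0⟩ := notMem_support_iff.1 h U (f.app U s) hxU
  exact ⟨V, hV, hxV, app_injective f V (by rw [app_res, h0, map_zero])⟩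

lemma support_subset_of_epi (f : K ⟶ F) [Epi f] : support F ⊆ support K := fun x hx => by
  by_contra h
  refine notMem_support_iff.2 (fun U s hxU => ?_) hx
  obtain ⟨V, hV, hxV, t, ht⟩ := locallySurjective_of_epi f U s x hxU
  obtain ⟨W, hW, hxW, h0⟩ := notMem_support_iff.1 h V t hxV
  exact ⟨W, hW.trans hV, hxW, by rw [← res_res F hV hW, ← ht, ← app_res, h0, map_zero]⟩

lemma isZero_of_forall_eq_zero (h : ∀ (U : X.Opens) (s : Γ(F, U)), s = 0) : IsZero F :=
  (IsZero.iff_id_eq_zero F).2 <| hom_ext_sections fun U _ => (h U _).trans (h U _).symm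

lemma exists_mem_support_of_ne_zero {U : X.Opens} {s : Γ(F, U)} (hs : s ≠ 0) :
    ∃ x ∈ U, x ∈ support F := by
  by_contra! h
  refine hs (section_ext fun p hp => ?_)
  obtain ⟨V, hV, hpV, h0⟩ := notMem_support_iff.1 (h p hp) U s hp
  exact ⟨V, hV, hpV, by rw [h0, map_zero]⟩

end Operations

/-! ### The structure sheaf of a closed subscheme -/

section Curve

variable {X C : Scheme.{u}} (ι : C ⟶ X)

/-- A function on the preimage of `U`, as a section of `𝒪_C` over `U`. -/
def toCurve {U : X.Opens} (f : Γ(C, ι ⁻¹ᵁ U)) : Γ(curveSheaf ι, U) := f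

lemma smul_curve {U : X.Opens} (a : Γ(X, U)) (f : Γ(C, ι ⁻¹ᵁ U)) :
    a • toCurve ι f = toCurve ι (ι.app U a * f) := rfl

lemma res_curve {U V : X.Opens} (h : V ≤ U) (f : Γ(C, ι ⁻¹ᵁ U)) :
    res (curveSheaf ι) h (toCurve ι f) = toCurve ι (resR (ι.preimage_mono h) f) := rfl

lemma resR_app {U V : X.Opens} (h : V ≤ U) (a : Γ(X, U)) :
    resR (ι.preimage_mono h) (ι.app U a) = ι.app V (resR h a) :=
  congr($((ι.naturality (homOfLE h).op).symm) a)

variable [IsClosedImmersion ι]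

lemma localizingAt_curveSheaf {U : X.Opens} (hU : IsAffineOpen U) :
    LocalizingAt (curveSheaf ι) U := by
  have hU' : IsAffineOpen (ι ⁻¹ᵁ U) := hU.preimage ι
  have key (f : Γ(X, U)) := hU'.isLocalization_of_eq_basicOpen (ι.app U f)
    (homOfLE (ι.preimage_mono (X.basicOpen_le f))) (Scheme.preimage_basicOpen ι f)
  have pow (f : Γ(X, U)) (n : ℕ) (t : Γ(C, ι ⁻¹ᵁ U)) :
      f ^ n • toCurve ι t = toCurve ι (ι.app U f ^ n * t) := by
    rw [smul_curve, map_pow]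
  refine ⟨fun f s => ?_, fun f t ht => ?_⟩
  · let := (C.presheaf.map (homOfLE (ι.preimage_mono (X.basicOpen_le f))).op).hom.toAlgebra
    have := key f
    obtain ⟨n, b, hb⟩ := IsLocalization.Away.surj (ι.app U f) (show Γ(C, ι ⁻¹ᵁ X.basicOpen f) from s)
    refine ⟨n, b, ?_⟩
    change resR _ b = ι.app (X.basicOpen f) (resR _ f ^ n) * (show Γ(C, ι ⁻¹ᵁ X.basicOpen f) from s)
    rw [map_pow, ← resR_app, mul_comm]
    exact hb.symm
  · let := (C.presheaf.map (homOfLE (ι.preimage_mono (X.basicOpen_le f))).op).hom.toAlgebra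
    have := key f
    obtain ⟨⟨_, n, rfl⟩, hn⟩ := (IsLocalization.map_eq_zero_iff (Submonoid.powers (ι.app U f))
      Γ(C, ι ⁻¹ᵁ X.basicOpen f) (show Γ(C, ι ⁻¹ᵁ U) from t)).1 ht
    exact ⟨n, (pow f n t).trans hn⟩

theorem isCoherent_curveSheaf [IsLocallyNoetherian X] : IsCoherent (curveSheaf ι) :=
  isCoherent_of_locally fun x => by
    obtain ⟨U, hU, hx⟩ := exists_affine_mem x
    have : Module.Finite Γ(X, U) Γ(structureSheaf X, U) :=
      inferInstanceAs (Module.Finite Γ(X, U) Γ(X, U))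
    exact ⟨U, hU, hx, localizingAt_curveSheaf ι hU,
      Module.Finite.of_surjective (appLinear (curveSection ι) U) (ι.app_surjective U hU)⟩

lemma locallySurjective_curveSection : LocallySurjective (curveSection ι) := by
  intro U y p hp
  obtain ⟨V, hV, hpV, hVU⟩ := exists_affine_le hp
  exact ⟨V, hVU, hpV, ι.app_surjective V hV _⟩

instance : Epi (curveSection ι) := epi_of_locallySurjective (locallySurjective_curveSection ι)

end Curve

/-! ### Points of a Cohen–Macaulay curve -/

section Topology

/-- A chain of two proper specializations gives dimension at least two. -/
lemma two_le_topologicalKrullDim {T : Type*} [TopologicalSpace T] {x y z : T} (hxy : x ⤳ y)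
    (hyx : ¬ y ⤳ x) (hyz : y ⤳ z) (hzy : ¬ z ⤳ y) : 2 ≤ topologicalKrullDim T := by
  let c (p : T) : IrreducibleCloseds T := ⟨closure {p}, isIrreducible_singleton.closure,
    isClosed_closure⟩
  have hlt {p q : T} (h : p ⤳ q) (h' : ¬ q ⤳ p) : c q < c p :=
    lt_of_le_not_ge (fun _ hr => h.closure_subset hr) fun hle =>
      h' (specializes_iff_closure_subset.2 hle)
  let s : LTSeries (IrreducibleCloseds T) :=
    { length := 2
      toFun := ![c z, c y, c x]
      step := fun i => match i with
        | 0 => hlt hyz hzy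
        | 1 => hlt hxy hyx }
  exact Order.LTSeries.length_le_krullDim s

variable {C : Scheme.{u}}

lemma exists_genericPoint_specializes (x : C) : ∃ η ∈ genericPoints C, η ⤳ x := by
  have h := irreducibleComponent_mem_irreducibleComponents x
  let Z : irreducibleComponents C := ⟨_, h⟩
  refine ⟨(genericPoints.ofComponent Z).1, (genericPoints.ofComponent Z).2, ?_⟩
  rw [specializes_iff_mem_closure]
  have := (genericPoints.isGenericPoint_ofComponent Z)
  rw [this.def]
  exact mem_irreducibleComponent

/-- Two proper specializations would form a chain of length two inside an irreducible component
through `x`, which has dimension one. -/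
lemma IsCohenMacaulayCurve.eq_or_eq_of_specializes (hC : IsCohenMacaulayCurve C) {x y z : C}
    (hxy : x ⤳ y) (hyz : y ⤳ z) : x = y ∨ y = z := by
  by_contra! h
  have hx := mem_irreducibleComponent (x := x)
  have hcl := isClosed_irreducibleComponent (x := x)
  have hy := hxy.mem_closed hcl hx
  have hz := hyz.mem_closed hcl hy
  have h2 := two_le_topologicalKrullDim (T := irreducibleComponent x) (x := ⟨x, hx⟩)
    (y := ⟨y, hy⟩) (z := ⟨z, hz⟩) ((subtype_specializes_iff _ _).2 hxy)
    (fun h' => h.1 (hxy.antisymm ((subtype_specializes_iff _ _).1 h')).eq)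
    ((subtype_specializes_iff _ _).2 hyz)
    (fun h' => h.2 (hyz.antisymm ((subtype_specializes_iff _ _).1 h')).eq)
  rw [hC.dim_component _ (irreducibleComponent_mem_irreducibleComponents x)] at h2
  exact absurd h2 (by decide)

/-- Passing to generic points turns a chain of irreducible closed subsets into a chain of
specializations. -/
lemma IsCohenMacaulayCurve.topologicalKrullDim_le_one (hC : IsCohenMacaulayCurve C) :
    topologicalKrullDim C ≤ 1 := by
  refine iSup_le fun s => ?_
  by_contra h
  have hlen : 2 ≤ s.length := by
    by_contra hlt
    exact h (by exact_mod_cast (show s.length ≤ 1 by omega))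
  have hlt (i j : Fin (s.length + 1)) (hij : i < j) : (s j).isIrreducible.genericPoint ⤳
      (s i).isIrreducible.genericPoint ∧ (s j).isIrreducible.genericPoint ≠
      (s i).isIrreducible.genericPoint := by
    have hcl (k) : closure {(s k).isIrreducible.genericPoint} = ((s k : IrreducibleCloseds C) : Set C) :=
      (s k).isIrreducible.closure_genericPoint (s k).isClosed
    have hsub := s.strictMono hij
    refine ⟨specializes_iff_closure_subset.2 ?_, fun e => hsub.ne' (SetLike.coe_injective ?_)⟩
    · rw [hcl, hcl]; exact hsub.le
    · exact (hcl j).symm.trans ((congr_arg (fun p => closure {p}) e).trans (hcl i))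
  have h01 := hlt ⟨0, by omega⟩ ⟨1, by omega⟩ (Fin.mk_lt_mk.2 one_pos)
  have h12 := hlt ⟨1, by omega⟩ ⟨2, by omega⟩ (Fin.mk_lt_mk.2 one_lt_two)
  rcases hC.eq_or_eq_of_specializes h12.1 h01.1 with e | e
  exacts [h12.2 e, h01.2 e]

lemma IsCohenMacaulayCurve.topologicalKrullDim_closure (hC : IsCohenMacaulayCurve C) {η : C}
    (hη : η ∈ genericPoints C) : topologicalKrullDim (closure {η} : Set C) = 1 :=
  hC.dim_component _ hη

lemma topologicalKrullDim_mono {T : Type*} [TopologicalSpace T] {A B : Set T} (h : A ⊆ B) :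
    topologicalKrullDim A ≤ topologicalKrullDim B :=
  (Topology.IsEmbedding.inclusion h).isInducing.topologicalKrullDim_le

lemma IsCohenMacaulayCurve.notMem_of_dim_le_zero (hC : IsCohenMacaulayCurve C) {Z : Set C}
    (hZ : IsClosed Z) (hZ' : topologicalKrullDim Z ≤ 0) {η : C} (hη : η ∈ genericPoints C) :
    η ∉ Z := fun h => by
  have := (topologicalKrullDim_mono (hZ.closure_subset_iff.2 (Set.singleton_subset_iff.2 h))).trans
    hZ'
  rw [hC.topologicalKrullDim_closure hη] at this
  exact absurd this (by decide)

end Topology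

/-! ### Absence of embedded points on a Cohen–Macaulay curve -/

section Depth

/-- Positive depth kills torsion at the closed point. Hypothesis `hp` says that the maximal ideal is
the only prime that can contain the annihilator of `h`; the role of `q` is to force positive
dimension. -/
lemma IsCohenMacaulayLocal.eq_zero {R : Type u} [CommRing R] [IsLocalRing R]
    (hR : IsCohenMacaulayLocal R) {h : R} {q : Ideal R} (hq : q.IsPrime)
    (hq' : q ≠ IsLocalRing.maximalIdeal R)
    (hp : ∀ p : Ideal R, p.IsPrime → (∀ a, a * h = 0 → a ∈ p) → p = IsLocalRing.maximalIdeal R) :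
    h = 0 := by
  obtain ⟨-, rs, hreg, hmem, hdim⟩ := hR
  cases rs with
  | nil =>
    -- An empty regular sequence means dimension zero, where every prime is maximal, contrary to the
    -- choice of `q`.
    have : Ring.KrullDimLE 0 R := ringKrullDimZero_iff_ringKrullDim_eq_zero.2 (by simpa using hdim.symm)
    exact absurd (IsLocalRing.eq_maximalIdeal hq.isMaximal') hq'
  | cons t rs =>
    have ht : IsSMulRegular R t :=
      ((RingTheory.Sequence.isRegular_cons_iff R t rs).1 hreg).1
    have htm := hmem t List.mem_cons_self
    -- `t` lies in every prime containing the annihilator of `h`, so a power of this nonzerodivisor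
    -- kills `h`.
    have hrad : t ∈ Ideal.radical (LinearMap.ker (LinearMap.toSpanSingleton R R h) : Ideal R) := by
      rw [Ideal.radical_eq_sInf, Submodule.mem_sInf]
      rintro p ⟨hle, hpp⟩
      rw [hp p hpp fun a ha => hle (by simpa using ha)]
      exact htm
    obtain ⟨k, hk⟩ := hrad
    have hk' : t ^ k • h = t ^ k • 0 := by simpa using hk
    exact ht.pow k hk'

variable {C : Scheme.{u}}

/-- A function on a Cohen–Macaulay curve which vanishes at the generic points is zero. -/
theorem IsCohenMacaulayCurve.eq_zero (hC : IsCohenMacaulayCurve C) {U : C.Opens} {f : Γ(C, U)}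
    (hf : ∀ η ∈ genericPoints C, η ∈ U → ∃ (W : C.Opens) (hW : W ≤ U), η ∈ W ∧ resR hW f = 0) :
    f = 0 := by
  refine TopCat.Presheaf.section_ext C.sheaf U f 0 fun x hx => ?_
  obtain ⟨V, hV, hxV, hVU⟩ := exists_affine_le hx
  -- On an affine open, vanishing near `η` amounts to being killed by a function that is invertible
  -- at `η`.
  have hloc : ∀ η ∈ genericPoints C, η ∈ V → ∃ a : Γ(C, V), η ∈ C.basicOpen a ∧ a * resR hVU f = 0 := by
    intro η hη hηV
    obtain ⟨W, hW, hηW, h0⟩ := hf η hη (hVU hηV)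
    obtain ⟨b, hb, hηb⟩ := hV.exists_basicOpen_le ⟨η, hηW⟩ hηV
    have := hV.isLocalization_basicOpen b
    have hz : algebraMap Γ(C, V) Γ(C, C.basicOpen b) (resR hVU f) = 0 := by
      change resR (C.basicOpen_le b) (resR hVU f) = 0
      rw [resR_resR, ← resR_resR hW hb, h0, map_zero]
    obtain ⟨⟨_, n, rfl⟩, hn⟩ := (IsLocalization.map_eq_zero_iff (Submonoid.powers b) _ _).1 hz
    -- The exponent must be positive for the basic open of the power to equal that of `b`.
    refine ⟨b ^ (n + 1), ?_, ?_⟩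
    · rwa [Scheme.basicOpen_pow _ _ n.succ_pos]
    · rw [pow_succ', mul_assoc]
      exact (congr_arg (b * ·) hn).trans (mul_zero b)
  have hgerm : C.presheaf.germ U x hx f = C.presheaf.germ V x hxV (resR hVU f) :=
    (C.presheaf.germ_res_apply (homOfLE hVU) x hxV f).symm
  -- Primes of the local ring at `x` correspond to generizations of `x`, the maximal ideal to `x`
  -- itself.
  have hprime (p : PrimeSpectrum (C.presheaf.stalk x)) :
      (C.fromSpecStalk x p ⤳ x) ∧ C.fromSpecStalk x p ∈ V ∧ ∀ a : Γ(C, V),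
        C.fromSpecStalk x p ∈ C.basicOpen a ↔ C.presheaf.germ V x hxV a ∉ p.asIdeal := by
    have h1 : C.fromSpecStalk x p ⤳ x := by
      have : C.fromSpecStalk x p ∈ Set.range (C.fromSpecStalk x) := ⟨p, rfl⟩
      rwa [Scheme.range_fromSpecStalk] at this
    refine ⟨h1, h1.mem_open V.2 hxV, fun a => ?_⟩
    rw [← hV.fromSpecStalk_eq_fromSpecStalk hxV]
    change Spec.map (C.presheaf.germ V x hxV) p ∈ hV.fromSpec ⁻¹ᵁ C.basicOpen a ↔ _
    rw [hV.fromSpec_preimage_basicOpen]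
    exact Iff.rfl
  have hmax (p : PrimeSpectrum (C.presheaf.stalk x)) :
      C.fromSpecStalk x p = x ↔ p.asIdeal = IsLocalRing.maximalIdeal (C.presheaf.stalk x) := by
    refine Iff.trans ?_ (show p = IsLocalRing.closedPoint (C.presheaf.stalk x) ↔ _ from
      PrimeSpectrum.ext_iff)
    refine Iff.trans ?_ (C.fromSpecStalk x).isEmbedding.injective.eq_iff
    rw [Scheme.fromSpecStalk_closedPoint]
  change C.presheaf.germ U x hx f = C.presheaf.germ U x hx 0
  rw [map_zero]
  by_contra hne
  have hnongen : x ∉ genericPoints C := fun hη => by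
    obtain ⟨a, hxa, ha⟩ := hloc x hη hxV
    have hu : IsUnit (C.presheaf.germ V x hxV a) := (C.mem_basicOpen _ _ hxV).1 hxa
    refine hne (hgerm.trans (hu.mul_right_eq_zero.1 ?_))
    rw [← map_mul, ha, map_zero]
  obtain ⟨η, hη, hηx⟩ := exists_genericPoint_specializes x
  obtain ⟨q, hq⟩ : η ∈ Set.range (C.fromSpecStalk x) := by rwa [Scheme.range_fromSpecStalk]
  -- The prime `q` of a generic point above the non-generic point `x` is not maximal. If `p`
  -- contains the annihilator of the germ, its point $y$ cannot be generic, since `hloc` gives an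
  -- annihilating function outside `p`; as chains have length at most one, $y=x$.
  refine hne ((hC.isCohenMacaulayLocal x).eq_zero q.isPrime
    (fun h => hnongen ((hq.symm.trans ((hmax q).2 h)) ▸ hη)) fun p hp hann => ?_)
  obtain ⟨h1, h2, h3⟩ := hprime ⟨p, hp⟩
  refine (hmax ⟨p, hp⟩).1 ?_
  obtain ⟨ξ, hξ, hξy⟩ := exists_genericPoint_specializes (C.fromSpecStalk x ⟨p, hp⟩)
  rcases hC.eq_or_eq_of_specializes hξy h1 with e | e
  · obtain ⟨a, hya, ha⟩ := hloc _ (e ▸ hξ) h2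
    refine absurd (hann _ ?_) ((h3 a).1 hya)
    rw [hgerm, ← map_mul, ha, map_zero]
  · exact e

end Depth

/-! ### The sheaf of homomorphisms from an ideal to the structure sheaf -/

section Dual

variable {X C : Scheme.{u}} (ι : C ⟶ X) {I J : C.IdealSheafData}

/-- A function in an ideal, as a section of the ideal sheaf. -/
def toIdeal {U : X.Opens} (g : Γ(C, ι ⁻¹ᵁ U)) (hg : g ∈ idealSections I (ι ⁻¹ᵁ U)) :
    Γ(idealOn ι I, U) :=
  (⟨g, hg⟩ : idealSections I (ι ⁻¹ᵁ U))

/-- A section of an ideal sheaf on `C`, as a function. -/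
def idealFun {U : X.Opens} (g : Γ(idealOn ι I, U)) : Γ(C, ι ⁻¹ᵁ U) :=
  idealVal (I := I) (U := ι ⁻¹ᵁ U) g

lemma idealFun_mem {U : X.Opens} (g : Γ(idealOn ι I, U)) :
    idealFun ι g ∈ idealSections I (ι ⁻¹ᵁ U) :=
  (show idealSections I (ι ⁻¹ᵁ U) from g).2

lemma idealFun_injective {U : X.Opens} : Function.Injective (idealFun ι (I := I) (U := U)) :=
  Subtype.val_injective

lemma idealFun_toIdeal {U : X.Opens} (g : Γ(C, ι ⁻¹ᵁ U)) (hg : g ∈ idealSections I (ι ⁻¹ᵁ U)) :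
    idealFun ι (toIdeal ι g hg) = g := rfl

lemma idealFun_smul {U : X.Opens} (a : Γ(X, U)) (g : Γ(idealOn ι I, U)) :
    idealFun ι (a • g) = ι.app U a * idealFun ι g := rfl

lemma idealFun_res {U V : X.Opens} (h : V ≤ U) (g : Γ(idealOn ι I, U)) :
    idealFun ι (res _ h g) = resR (ι.preimage_mono h) (idealFun ι g) := rfl

variable {ι}

/-- The value of a section of `ℋom(I, 𝒪_C)` over `U` on sections over a smaller open set. -/
def dualApp {U : X.Opens} (φ : Γ(idealDual ι I, U)) {V : X.Opens} (h : V ≤ U) :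
    Γ(idealOn ι I, V) →ₗ[Γ(X, V)] Γ(curveSheaf ι, V) :=
  (show homSections (idealOn ι I) (curveSheaf ι) U from φ).1 ⟨V, h⟩

lemma res_dualApp {U V W : X.Opens} (φ : Γ(idealDual ι I, U)) (hV : V ≤ U) (hW : W ≤ V)
    (g : Γ(idealOn ι I, V)) :
    res _ hW (dualApp φ hV g) = dualApp φ (hW.trans hV) (res _ hW g) :=
  ((show homSections (idealOn ι I) (curveSheaf ι) U from φ).2 ⟨V, hV⟩ ⟨W, hW.trans hV⟩ hW g).symm

lemma dualApp_res {U V W : X.Opens} (φ : Γ(idealDual ι I, U)) (hV : V ≤ U) (hW : W ≤ V) :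
    dualApp (res _ hV φ) hW = dualApp φ (hW.trans hV) := rfl

lemma dualApp_smul {U V : X.Opens} (a : Γ(X, U)) (φ : Γ(idealDual ι I, U)) (hV : V ≤ U)
    (g : Γ(idealOn ι I, V)) : dualApp (a • φ) hV g = resR hV a • dualApp φ hV g := rfl

lemma dualApp_mulHom {U V : X.Opens} (f : Γ(C, ι ⁻¹ᵁ U)) (hV : V ≤ U) (g : Γ(idealOn ι I, V)) :
    dualApp ((mulHom ι I).app U (toCurve ι f)) hV g =
      toCurve ι (resR (ι.preimage_mono hV) f * idealFun ι g) := rfl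

lemma dualApp_zero {U V : X.Opens} (hV : V ≤ U) (g : Γ(idealOn ι I, V)) :
    dualApp (0 : Γ(idealDual ι I, U)) hV g = toCurve ι 0 := rfl

lemma mul_eq_zero_of_mulHom_eq_zero {U V : X.Opens} {f : Γ(C, ι ⁻¹ᵁ U)}
    (hf : (mulHom ι I).app U (toCurve ι f) = 0) (hV : V ≤ U) (g : Γ(idealOn ι I, V)) :
    resR (ι.preimage_mono hV) f * idealFun ι g = 0 := by
  have h := dualApp_mulHom f hV g
  rw [hf, dualApp_zero] at h
  exact h.symm

lemma dualApp_res_of_eq {U V W : X.Opens} {φ : Γ(idealDual ι I, U)} {hV : V ≤ U}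
    {g : Γ(idealOn ι I, V)} {f : Γ(C, ι ⁻¹ᵁ V)} (hf : dualApp φ hV g = toCurve ι f) (hW : W ≤ V) :
    dualApp φ (hW.trans hV) (res _ hW g) = toCurve ι (resR (ι.preimage_mono hW) f) := by
  rw [← res_dualApp φ hV hW g, hf, res_curve]

lemma dual_ext {U : X.Opens} {φ ψ : Γ(idealDual ι I, U)}
    (h : ∀ (V : X.Opens) (hV : V ≤ U), IsAffineOpen V → ∀ g : Γ(idealOn ι I, V),
      dualApp φ hV g = dualApp ψ hV g) : φ = ψ := by
  refine Subtype.ext (funext fun V => LinearMap.ext fun g => ?_)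
  change dualApp φ V.2 g = dualApp ψ V.2 g
  refine section_ext fun p hp => ?_
  obtain ⟨W, hW, hpW, hWV⟩ := exists_affine_le hp
  exact ⟨W, hWV, hpW, by rw [res_dualApp, res_dualApp, h _ _ hW]⟩

/-- The restriction map `ℋom(I, 𝒪_C) ⟶ ℋom(J, 𝒪_C)` for `J ⊆ I`. -/
abbrev dualRes (ι : C ⟶ X) (h : J ≤ I) : idealDual ι I ⟶ idealDual ι J :=
  sheafHomPrecomp _ ((Scheme.Modules.pushforward ι).map (idealInclusion h))

lemma π_comp_dualQuotientMap (ι : C ⟶ X) (h : J ≤ I) :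
    cokernel.π (mulHom ι I) ≫ dualQuotientMap ι h =
      dualRes ι h ≫ cokernel.π (mulHom ι J) :=
  cokernel.π_desc _ _ _

lemma dualApp_dualRes (h : J ≤ I) {U V : X.Opens} (φ : Γ(idealDual ι I, U)) (hV : V ≤ U)
    (g : Γ(idealOn ι J, V)) : dualApp ((dualRes ι h).app U φ) hV g =
      dualApp φ hV (toIdeal ι (idealFun ι g) (idealSections_mono h _ (idealFun_mem ι g))) := rfl

/-- A homomorphism on `I` that becomes multiplication by a function `k` on `J` agrees with
multiplication by `k` on all of `I`, because restriction to `J` is injective. -/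
lemma mono_dualQuotientMap (h : J ≤ I) [Mono (dualRes ι h)] : Mono (dualQuotientMap ι h) := by
  have hcomp (U : X.Opens) (φ : Γ(idealDual ι I, U)) :
      (dualQuotientMap ι h).app U ((cokernel.π (mulHom ι I)).app U φ) =
        (cokernel.π (mulHom ι J)).app U ((dualRes ι h).app U φ) :=
    congr(($(π_comp_dualQuotientMap ι h)).app U φ)
  refine mono_of_locally_eq_zero _ fun U z hz p hp => ?_
  obtain ⟨V, hV, hpV, φ, hφ⟩ := locallySurjective_of_epi (cokernel.π (mulHom ι I)) U z p hp
  obtain ⟨W, hW, hpW, k, hk⟩ := exists_locally_of_cokernel_eq_zero (mulHom ι J)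
    (y := (dualRes ι h).app V φ) (by rw [← hcomp, hφ, app_res, hz, map_zero]) p hpV
  refine ⟨W, hW.trans hV, hpW, ?_⟩
  have hk' : (mulHom ι I).app W k = res _ hW φ :=
    app_injective (dualRes ι h) W (by
      rw [app_res, ← hk]
      exact congr(($(mulHom_precomp ι h)).app W k))
  rw [← res_res _ hV hW, ← hφ, ← app_res, ← hk', app_cokernel_π]

variable [IsClosedImmersion ι]

/-- `φ(g) g' = φ(g') g` for `g, g' ∈ I`. -/
lemma dualApp_mul_comm {U V : X.Opens} (φ : Γ(idealDual ι I, U)) (hV : V ≤ U)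
    (hVa : IsAffineOpen V) {a : Γ(X, V)} {g : Γ(idealOn ι I, V)} (ha : ι.app V a = idealFun ι g)
    {f : Γ(C, ι ⁻¹ᵁ V)} (hf : dualApp φ hV g = toCurve ι f) (g' : Γ(idealOn ι I, V)) :
    a • dualApp φ hV g' = toCurve ι (f * idealFun ι g') := by
  obtain ⟨a', ha'⟩ := ι.app_surjective V hVa (idealFun ι g')
  have h : a • g' = a' • g := idealFun_injective ι (by
    rw [idealFun_smul, idealFun_smul, ha, ha', mul_comm])
  rw [← map_smul, h, map_smul, ← ha', mul_comm, hf, smul_curve]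

/-- The identity $g\varphi=\varphi(g)$, that is $g\,\varphi(g')=\varphi(gg')=\varphi(g)\,g'$. The
function `a` on $X$ lifts $g$ because $\mathcal Hom(I,\mathcal O_C)$ is a sheaf of $\mathcal
O_X$-modules. -/
lemma smul_dual {U V : X.Opens} (φ : Γ(idealDual ι I, U)) (hV : V ≤ U)
    {a : Γ(X, V)} {g : Γ(idealOn ι I, V)} (ha : ι.app V a = idealFun ι g) :
    a • res _ hV φ = (mulHom ι I).app V (dualApp φ hV g) := by
  obtain ⟨f, hf⟩ : ∃ f : Γ(C, ι ⁻¹ᵁ V), dualApp φ hV g = toCurve ι f := ⟨_, rfl⟩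
  refine dual_ext fun W hW hWa g' => ?_
  rw [dualApp_smul, dualApp_res, dualApp_mul_comm φ (hW.trans hV) hWa (g := res _ hW g)
    (by rw [idealFun_res, ← ha, resR_app]) (dualApp_res_of_eq hf hW), hf, dualApp_mulHom]

/-- If only the zero function is annihilated by `J`, then homomorphisms on `I ⊇ J` are determined by
their restriction to `J`. -/
lemma mono_dualRes_of_eq_zero (h : J ≤ I)
    (hJ : ∀ (V : X.Opens) (f : Γ(C, ι ⁻¹ᵁ V)), (∀ (W : X.Opens) (hW : W ≤ V), IsAffineOpen W →
      ∀ g : Γ(idealOn ι J, W), resR (ι.preimage_mono hW) f * idealFun ι g = 0) → f = 0) :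
    Mono (dualRes ι h) :=
  mono_of_injective _ fun U => (injective_iff_map_eq_zero _).2 fun φ hφ => by
    refine dual_ext fun V hV hVa g => ?_
    obtain ⟨f, hf⟩ : ∃ f : Γ(C, ι ⁻¹ᵁ V), dualApp φ hV g = toCurve ι f := ⟨_, rfl⟩
    rw [hf, dualApp_zero]
    refine congr_arg (toCurve ι) (hJ V f fun W hW hWa g' => ?_)
    have h0 := dualApp_dualRes h φ (hW.trans hV) g'
    rw [hφ, dualApp_zero] at h0
    obtain ⟨a, ha⟩ := ι.app_surjective W hWa (idealFun ι (res _ hW g))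
    -- For $g'\in J$ one has $\varphi(g)g'=g\varphi(g')=0$.
    have h1 := dualApp_mul_comm φ (hW.trans hV) hWa ha (dualApp_res_of_eq hf hW)
      (toIdeal ι (idealFun ι g') (idealSections_mono h _ (idealFun_mem ι g')))
    rw [← h0, smul_curve, mul_zero, idealFun_toIdeal] at h1
    exact h1.symm

end Dual

/-! ### Injectivity of the maps out of $\mathcal O_C$ and of the transition maps -/

section Injectivity

variable {X C : Scheme.{u}} {ι : C ⟶ X} [IsClosedImmersion ι] {m : C.IdealSheafData}

lemma exists_mem_ideal_basicOpen {x : C} (hx : x ∉ m.support) {U : C.affineOpens} (hxU : x ∈ U.1) :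
    ∃ g ∈ m.ideal U, x ∈ C.basicOpen g := by
  rw [Scheme.IdealSheafData.mem_support_iff_of_mem hxU, Scheme.mem_zeroLocus_iff] at hx
  push Not at hx
  exact hx

lemma pow_mem_idealSections {U : C.affineOpens} {g : Γ(C, U.1)} (hg : g ∈ m.ideal U) (r : ℕ) :
    g ^ r ∈ idealSections (m ^ r) U.1 := by
  rw [idealSections_affine, Scheme.IdealSheafData.ideal_pow]
  exact Ideal.pow_mem_pow hg r

variable (hC : IsCohenMacaulayCurve C) (hm : topologicalKrullDim m.support ≤ 0)

include hC hm

/-- A function annihilated by a power of `𝔪` is zero. -/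
lemma eq_zero_of_mul_pow (r : ℕ) {V : X.Opens} {f : Γ(C, ι ⁻¹ᵁ V)}
    (hf : ∀ (W : X.Opens) (hW : W ≤ V), IsAffineOpen W → ∀ g : Γ(idealOn ι (m ^ r), W),
      resR (ι.preimage_mono hW) f * idealFun ι g = 0) : f = 0 := by
  refine hC.eq_zero fun η hη hηV => ?_
  obtain ⟨W, hWa, hηW, hW⟩ := exists_affine_le (x := ι η) hηV
  have hWC : IsAffineOpen (ι ⁻¹ᵁ W) := hWa.preimage ι
  -- The generic point lies off the zero locus of $\mathfrak m$, so $\mathfrak m$ contains a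
  -- function invertible there; its `r`-th power kills `f`.
  obtain ⟨g, hg, hηg⟩ := exists_mem_ideal_basicOpen
    (hC.notMem_of_dim_le_zero m.support.isClosed hm hη) (U := ⟨ι ⁻¹ᵁ W, hWC⟩) hηW
  have h0 : resR (ι.preimage_mono hW) f * g ^ r = 0 :=
    hf W hW hWa (toIdeal ι (g ^ r) (pow_mem_idealSections hg r))
  refine ⟨C.basicOpen g, (C.basicOpen_le g).trans (ι.preimage_mono hW), hηg, ?_⟩
  have h1 := congr(resR (C.basicOpen_le g) $h0)
  rw [map_mul, map_zero, map_pow, resR_resR] at h1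
  exact ((isUnit_resR_basicOpen g).pow r).mul_left_eq_zero.1 h1

lemma mono_mulHom (r : ℕ) : Mono (mulHom ι (m ^ r)) :=
  mono_of_injective _ fun U => (injective_iff_map_eq_zero _).2 fun f hf => by
    exact eq_zero_of_mul_pow hC hm r (f := (show Γ(C, ι ⁻¹ᵁ U) from f)) fun W hW _ g =>
      mul_eq_zero_of_mulHom_eq_zero hf hW g

lemma mono_dualRes {r r' : ℕ} (h : r ≤ r') : Mono (dualRes ι (pow_anti m h)) :=
  mono_dualRes_of_eq_zero (pow_anti m h) fun _ _ hf => eq_zero_of_mul_pow hC hm r' hf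

lemma mono_transition {r r' : ℕ} (h : r ≤ r') : Mono (transition ι m h) :=
  have := mono_dualRes (ι := ι) hC hm h
  mono_dualQuotientMap (pow_anti m h)

end Injectivity

/-! ### Subsheaves of the quotient and their inverse images -/

section InverseImage

variable {X C : Scheme.{u}} (ι : C ⟶ X) {I : C.IdealSheafData}

lemma subobject_le_of_epi {A : X.Modules} {B : X.Modules} {Q Q' : Subobject B}
    (p : A ⟶ (Q : X.Modules)) [Epi p] (w : A ⟶ (Q' : X.Modules)) (h : p ≫ Q.arrow = w ≫ Q'.arrow) :
    Q ≤ Q' := by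
  have sq : CommSq w p Q'.arrow Q.arrow := ⟨h.symm⟩
  have : StrongEpi p := strongEpi_of_epi p
  exact Subobject.le_of_comm sq.lift sq.fac_right

lemma imageSubobject_epi_comp {A B D : X.Modules} (p : A ⟶ B) [Epi p] (f : B ⟶ D) :
    imageSubobject (p ≫ f) = imageSubobject f :=
  le_antisymm (imageSubobject_comp_le p f)
    (subobject_le_of_epi (p ≫ factorThruImageSubobject f) (factorThruImageSubobject (p ≫ f))
      (by simp))

lemma isIso_factorThruImageSubobject {A B : X.Modules} (f : A ⟶ B) [Mono f] :
    IsIso (factorThruImageSubobject f) := by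
  have : Mono (factorThruImageSubobject f) := mono_of_mono_fac (imageSubobject_arrow_comp f)
  exact isIso_of_mono_of_epi _

variable {ι} {F : X.Modules} (s : curveSheaf ι ⟶ F) (j : F ⟶ idealDual ι I) [Mono j]
  (hj : s ≫ j = mulHom ι I)

include hj in
/-- A sheaf between `𝒪_C` and `ℋom(I, 𝒪_C)` is the inverse image of its image in the quotient. -/
theorem exists_iso_inverseImage :
    ∃ e : F ≅ inverseImage ι (imageSubobject (j ≫ cokernel.π (mulHom ι I))),
      s ≫ e.hom = toInverseImage ι _ := by
  set Q := imageSubobject (j ≫ cokernel.π (mulHom ι I))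
  let fst : inverseImage ι Q ⟶ (Q : X.Modules) := pullback.fst _ _
  let snd : inverseImage ι Q ⟶ idealDual ι I := pullback.snd _ _
  have hcond : fst ≫ Q.arrow = snd ≫ cokernel.π (mulHom ι I) := pullback.condition
  have : Mono snd := inferInstanceAs (Mono (pullback.snd _ _))
  let u : F ⟶ inverseImage ι Q := pullback.lift (factorThruImageSubobject _) j
    (imageSubobject_arrow_comp _)
  have hu : u ≫ snd = j := pullback.lift_snd _ _ _
  have hu1 : u ≫ fst = factorThruImageSubobject _ := pullback.lift_fst _ _ _
  have : Mono u := mono_of_mono_fac hu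
  have hepi : Epi u := epi_of_locallySurjective fun U y p hp => by
    obtain ⟨V, hV, hpV, x, hx⟩ := locallySurjective_of_epi
      (factorThruImageSubobject (j ≫ cokernel.π (mulHom ι I))) U
      (fst.app U y) p hp
    -- `x` and `y` have the same image in $Q$, so inside $\mathcal Hom(I,\mathcal O_C)$ they differ
    -- locally by a function `k`, and `s k + x` is mapped to `y`.
    have h0 : (cokernel.π (mulHom ι I)).app V (snd.app V
        (res _ hV y - u.app V x)) = 0 := by
      have e (z : Γ(inverseImage ι Q, V)) : Q.arrow.app V (fst.app V z) =
        (cokernel.π (mulHom ι I)).app V (snd.app V z) :=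
        congr(($hcond).app V z)
      rw [← e, map_sub, app_res, ← hx]
      rw [show fst.app V (u.app V x) = _ from
        congr(($hu1).app V x), sub_self, map_zero]
    obtain ⟨W, hW, hpW, k, hk⟩ := exists_locally_of_cokernel_eq_zero (mulHom ι I) h0 p hpV
    refine ⟨W, hW.trans hV, hpW, s.app W k + res _ hW x, ?_⟩
    refine app_injective snd W ?_
    have hk' : snd.app W (u.app W (s.app W k)) = _ :=
      congr(($(show s ≫ u ≫ snd = _ from (s ≫= hu).trans hj)).app W k)
    rw [map_add, map_add, hk', hk, app_res, app_res, app_res, map_sub, map_sub, app_res, res_res,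
      sub_add_cancel]
  have : IsIso u := isIso_of_mono_of_epi u
  refine ⟨asIso u, ?_⟩
  rw [asIso_hom, ← cancel_mono (pullback.snd Q.arrow (cokernel.π (mulHom ι I))), Category.assoc, hu,
    hj, pullback.lift_snd]

include hj in
/-- The cokernel of `𝒪_C ⟶ F` is the image of `F` in the quotient. -/
theorem nonempty_cokernel_iso_imageSubobject :
    Nonempty (cokernel s ≅ (imageSubobject (j ≫ cokernel.π (mulHom ι I)) : X.Modules)) := by
  let p := factorThruImageSubobject (j ≫ cokernel.π (mulHom ι I))
  have hp : p ≫ (imageSubobject _).arrow = j ≫ cokernel.π (mulHom ι I) :=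
    imageSubobject_arrow_comp _
  have h0 : s ≫ p = 0 := by
    rw [← cancel_mono (imageSubobject (j ≫ cokernel.π (mulHom ι I))).arrow, Category.assoc, hp,
      ← Category.assoc, hj, cokernel.condition, zero_comp]
  have hd : cokernel.π s ≫ cokernel.desc s p h0 = p := cokernel.π_desc _ _ _
  have : Epi (cokernel.desc s p h0) := epi_of_epi_fac hd
  have : Mono (cokernel.desc s p h0) := by
    refine mono_of_locally_eq_zero _ fun U z hz x hx => ?_
    obtain ⟨V, hV, hxV, y, hy⟩ := locallySurjective_of_epi (cokernel.π s) U z x hx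
    have h1 : p.app V y = 0 := by
      have e : (cokernel.desc s p h0).app V ((cokernel.π s).app V y) = p.app V y :=
        congr(($hd).app V y)
      rw [← e, hy, app_res, hz, map_zero]
    have h2 : (cokernel.π (mulHom ι I)).app V (j.app V y) = 0 :=
      (congr(($hp).app V y)).symm.trans
        ((congr_arg ((imageSubobject (j ≫ cokernel.π (mulHom ι I))).arrow.app V) h1).trans
          (map_zero ((imageSubobject (j ≫ cokernel.π (mulHom ι I))).arrow.app V).hom))
    obtain ⟨W, hW, hxW, k, hk⟩ := exists_locally_of_cokernel_eq_zero (mulHom ι I) h2 x hxV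
    refine ⟨W, hW.trans hV, hxW, ?_⟩
    have h3 : s.app W k = res _ hW y := app_injective j W (by
      rw [app_res, ← hk, ← hj]; rfl)
    rw [← res_res _ hV hW, ← hy, ← app_res, ← h3, app_cokernel_π]
  have : IsIso (cokernel.desc s p h0) := isIso_of_mono_of_epi _
  exact ⟨asIso (cokernel.desc s p h0)⟩

end InverseImage

/-! ### The pair attached to a subsheaf -/

section Subsheaf

variable {X C : Scheme.{u}} {ι : C ⟶ X} {I : C.IdealSheafData}

/-- The inclusion of the inverse image of `Q` into `ℋom(I, 𝒪_C)`. -/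
abbrev inverseImageι (Q : Subobject (dualQuotient ι I)) : inverseImage ι Q ⟶ idealDual ι I :=
  pullback.snd _ _

lemma toInverseImage_ι (Q : Subobject (dualQuotient ι I)) :
    toInverseImage ι Q ≫ inverseImageι Q = mulHom ι I :=
  pullback.lift_snd _ _ _

lemma toInverseImage_ι_app (Q : Subobject (dualQuotient ι I)) {U : X.Opens}
    (f : Γ(curveSheaf ι, U)) :
    (inverseImageι Q).app U ((toInverseImage ι Q).app U f) = (mulHom ι I).app U f :=
  congr(($(toInverseImage_ι Q)).app U f)

instance mono_toInverseImage [Mono (mulHom ι I)] (Q : Subobject (dualQuotient ι I)) :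
    Mono (toInverseImage ι Q) :=
  mono_of_mono_fac (toInverseImage_ι Q)

instance epi_inverseImage_fst (Q : Subobject (dualQuotient ι I)) :
    Epi (pullback.fst Q.arrow (cokernel.π (mulHom ι I))) :=
  inferInstance

/-- A map into $F_Q$ that dies in $Q$ dies in $\mathcal Hom(I,\mathcal O_C)/\mathcal O_C$, hence
factors through $\mathcal O_C$. -/
lemma exact_toInverseImage [Mono (mulHom ι I)] (Q : Subobject (dualQuotient ι I)) :
    (ShortComplex.mk (toInverseImage ι Q) (pullback.fst Q.arrow (cokernel.π (mulHom ι I)))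
      (pullback.lift_fst _ _ _)).Exact := by
  have hlift {A : X.Modules} (k : A ⟶ inverseImage ι Q)
      (hk : k ≫ pullback.fst Q.arrow (cokernel.π (mulHom ι I)) = 0) :
      (k ≫ inverseImageι Q) ≫ cokernel.π (mulHom ι I) = 0 := by
    rw [Category.assoc, ← pullback.condition, ← Category.assoc, hk, zero_comp]
  have hmono : Mono (ShortComplex.mk _ _ (cokernel.condition (mulHom ι I))).f :=
    inferInstanceAs (Mono (mulHom ι I))
  let l {A : X.Modules} (k : A ⟶ inverseImage ι Q)
      (hk : k ≫ pullback.fst Q.arrow (cokernel.π (mulHom ι I)) = 0) : A ⟶ curveSheaf ι :=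
    (ShortComplex.exact_cokernel (mulHom ι I)).lift _ (hlift k hk)
  have hl {A : X.Modules} (k : A ⟶ inverseImage ι Q)
      (hk : k ≫ pullback.fst Q.arrow (cokernel.π (mulHom ι I)) = 0) :
      l k hk ≫ toInverseImage ι Q = k := by
    rw [← cancel_mono (inverseImageι Q), Category.assoc, toInverseImage_ι]
    exact (ShortComplex.exact_cokernel (mulHom ι I)).lift_f _ (hlift k hk)
  refine ShortComplex.exact_of_f_is_kernel _ (KernelFork.IsLimit.ofι _ _ l hl
    (fun {A} k hk b hb => ?_))
  exact (cancel_mono (toInverseImage ι Q)).1 (hb.trans (hl k hk).symm)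

theorem shortExact_subsheafSequence [Mono (mulHom ι I)] (Q : Subobject (dualQuotient ι I)) :
    (subsheafSequence ι Q).ShortExact where
  exact := exact_toInverseImage Q
  mono_f := mono_toInverseImage Q
  epi_g := epi_inverseImage_fst Q

lemma smul_idealDual_eq_zero {U : X.Opens} {a : Γ(X, U)} (ha : ι.app U a = 0)
    (φ : Γ(idealDual ι I, U)) : a • φ = 0 := by
  refine dual_ext fun V hV _ g => ?_
  rw [dualApp_smul]
  change ι.app V (resR hV a) * (show Γ(C, ι ⁻¹ᵁ V) from dualApp φ hV g) = 0
  rw [← resR_app, ha, map_zero, zero_mul]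

variable [IsClosedImmersion ι]

/-- A morphism between inverse images compatible with the maps from `𝒪_C` is compatible with the
inclusions into `ℋom(I, 𝒪_C)`. -/
lemma comp_inverseImageι [Mono (mulHom ι I)] {Q Q' : Subobject (dualQuotient ι I)}
    (e : inverseImage ι Q ⟶ inverseImage ι Q') (he : toInverseImage ι Q ≫ e = toInverseImage ι Q') :
    e ≫ inverseImageι Q' = inverseImageι Q := by
  refine hom_ext_sections fun U y => dual_ext fun V hV hVa g => ?_
  change dualApp ((inverseImageι Q').app U (e.app U y)) hV g = _
  obtain ⟨a, ha⟩ := ι.app_surjective V hVa (idealFun ι g)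
  have h1 := smul_dual ((inverseImageι Q).app U y) hV ha
  have h2 := smul_dual ((inverseImageι Q').app U (e.app U y)) hV ha
  have h3 : a • res _ hV y =
      (toInverseImage ι Q).app V (dualApp ((inverseImageι Q).app U y) hV g) := by
    refine app_injective (inverseImageι Q) V ?_
    rw [app_smul', app_res, h1, toInverseImage_ι_app]
  -- Let $\varphi$ be the homomorphism given by $y$. Then $ay=\varphi(g)$ already lies in $\mathcal
  -- O_C$, which `e` fixes. So $a\,e(y)=\varphi(g)$, and by `smul_dual` the homomorphism given by
  -- $e(y)$ takes the same value at $g$.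
  have h4 : a • res _ hV (e.app U y) =
      (toInverseImage ι Q').app V (dualApp ((inverseImageι Q).app U y) hV g) := by
    rw [← app_res, ← app_smul', h3]
    exact congr(($he).app V _)
  refine app_injective (mulHom ι I) V ?_
  rw [← h2, ← app_res, ← app_smul', h4, toInverseImage_ι_app]

/-- Since $\mathcal O_X\to\mathcal O_C$ is epi, an isomorphism of pairs is compatible with the maps
from $\mathcal O_C$ and hence with the inclusions into $\mathcal Hom(I,\mathcal O_C)$. Taking images
in the quotient gives both inequalities. -/
theorem subobject_eq_of_isomorphic [Mono (mulHom ι I)] {Q Q' : Subobject (dualQuotient ι I)}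
    (h : (subsheafPair ι Q).Isomorphic (subsheafPair ι Q')) : Q = Q' := by
  have key {Q Q' : Subobject (dualQuotient ι I)} (e : inverseImage ι Q ⟶ inverseImage ι Q')
      (he : (curveSection ι ≫ toInverseImage ι Q) ≫ e = curveSection ι ≫ toInverseImage ι Q') :
      Q ≤ Q' := by
    have he' : toInverseImage ι Q ≫ e = toInverseImage ι Q' := by
      rw [← cancel_epi (curveSection ι), ← Category.assoc, he]
    refine subobject_le_of_epi (pullback.fst Q.arrow (cokernel.π (mulHom ι I)))
      (e ≫ pullback.fst Q'.arrow (cokernel.π (mulHom ι I))) ?_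
    rw [Category.assoc, pullback.condition, pullback.condition, ← Category.assoc,
      comp_inverseImageι e he']
  obtain ⟨e, he⟩ := h
  let e' : inverseImage ι Q ≅ inverseImage ι Q' := e
  refine le_antisymm (key e'.hom he) (key e'.inv ?_)
  rw [Iso.comp_inv_eq]
  exact he.symm

/-- Away from the zero locus of `𝔪`, the ideal `𝔪^r` contains a unit. -/
lemma exists_isUnit_mem {m : C.IdealSheafData} {x : X} (hx : x ∉ ι '' (m.support : Set C)) (r : ℕ)
    {U : X.Opens} (hxU : x ∈ U) : ∃ V : X.Opens, IsAffineOpen V ∧ V ≤ U ∧ x ∈ V ∧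
      ∃ a : Γ(X, V), IsUnit a ∧ ι.app V a ∈ idealSections (m ^ r) (ι ⁻¹ᵁ V) := by
  by_cases hr : x ∈ Set.range ι
  · obtain ⟨y, rfl⟩ := hr
    have hy : y ∉ m.support := fun h => hx ⟨y, h, rfl⟩
    obtain ⟨V, hVa, hyV, hV⟩ := exists_affine_le hxU
    obtain ⟨g, hg, hyg⟩ := exists_mem_ideal_basicOpen hy (U := ⟨ι ⁻¹ᵁ V, hVa.preimage ι⟩) hyV
    obtain ⟨b, rfl⟩ := ι.app_surjective V hVa g
    refine ⟨X.basicOpen b, hVa.basicOpen b, (X.basicOpen_le b).trans hV, ?_,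
      resR (X.basicOpen_le b) b ^ r, (isUnit_resR_basicOpen b).pow r, ?_⟩
    · change y ∈ ι ⁻¹ᵁ X.basicOpen b
      rwa [Scheme.preimage_basicOpen]
    · rw [← map_pow, ← resR_app, map_pow]
      exact idealSections_res _ (ι.preimage_mono (X.basicOpen_le b)) (pow_mem_idealSections hg r)
  -- Off $C$ all functions on the preimage are zero, so even `1` maps into the ideal.
  · let V : X.Opens := ⟨(Set.range ι)ᶜ, ι.isClosedEmbedding.isClosed_range.isOpen_compl⟩
    obtain ⟨W, hWa, hxW, hW⟩ := exists_affine_le (U := U ⊓ V) ⟨hxU, hr⟩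
    have hV : ι ⁻¹ᵁ W = ⊥ := by
      rw [eq_bot_iff]
      intro y hy
      exact (hW hy).2 ⟨y, rfl⟩
    have : Subsingleton Γ(C, ι ⁻¹ᵁ W) := by
      rw [hV]
      infer_instance
    exact ⟨W, hWa, hW.trans inf_le_left, hxW, 1, isUnit_one, by
      rw [Subsingleton.elim (ι.app W 1) 0]
      exact zero_mem _⟩

/-- Away from the zero locus of `𝔪`, the map `𝒪_C ⟶ ℋom(𝔪^r, 𝒪_C)` is surjective. -/
lemma exists_mulHom_eq {m : C.IdealSheafData} {x : X} (hx : x ∉ ι '' (m.support : Set C)) (r : ℕ)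
    {U : X.Opens} (hxU : x ∈ U) (φ : Γ(idealDual ι (m ^ r), U)) :
    ∃ (V : X.Opens) (hV : V ≤ U), x ∈ V ∧ ∃ f, (mulHom ι (m ^ r)).app V f = res _ hV φ := by
  obtain ⟨V, hVa, hV, hxV, _, ⟨v, rfl⟩, hav⟩ := exists_isUnit_mem hx r hxU
  -- By `smul_dual`, $\varphi=v^{-1}\varphi(v)$ for a unit $v$ in the ideal.
  refine ⟨V, hV, hxV, (↑v⁻¹ : Γ(X, V)) • dualApp φ hV (toIdeal ι _ hav), ?_⟩
  rw [app_smul', ← smul_dual φ hV (idealFun_toIdeal ι _ hav).symm, smul_smul, Units.inv_mul,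
    one_smul]

lemma support_coker_subsheafPair {m : C.IdealSheafData} (r : ℕ)
    (Q : Subobject (dualQuotient ι (m ^ r))) :
    support (subsheafPair ι Q).coker ⊆ ι '' (m.support : Set C) := fun x hx => by
  change x ∈ support (cokernel (curveSection ι ≫ toInverseImage ι Q)) at hx
  by_contra hxm
  refine notMem_support_iff.2 (fun U z hxU => ?_) hx
  obtain ⟨V, hV, hxV, y, hy⟩ := locallySurjective_of_epi
    (cokernel.π (curveSection ι ≫ toInverseImage ι Q)) U z x hxU
  obtain ⟨W, hW, hxW, f, hf⟩ := exists_mulHom_eq hxm r hxV ((inverseImageι Q).app V y)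
  have hf' : (toInverseImage ι Q).app W f = res _ hW y :=
    app_injective (inverseImageι Q) W (by rw [toInverseImage_ι_app, hf, app_res])
  obtain ⟨W', hW', hxW', a, ha⟩ := locallySurjective_of_epi (curveSection ι) W f x hxW
  refine ⟨W', hW'.trans (hW.trans hV), hxW', ?_⟩
  have h0 : (curveSection ι ≫ toInverseImage ι Q).app W' a = res _ (hW'.trans hW) y := by
    change (toInverseImage ι Q).app W' ((curveSection ι).app W' a) = _
    rw [ha, app_res, hf', res_res]
  rw [← res_res _ hV (hW'.trans hW), ← hy, ← app_res, ← h0, app_cokernel_π]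

lemma topologicalKrullDim_image (S : Set C) :
    topologicalKrullDim (ι '' S) = topologicalKrullDim S :=
  ((ι.isEmbedding.homeomorphImage S).isHomeomorph.topologicalKrullDim_eq).symm

/-- A function that kills $F_Q$ kills $1\in\mathcal O_C\subset F_Q$, so it vanishes on $C$;
conversely, functions vanishing on $C$ kill all of $\mathcal Hom(I,\mathcal O_C)$. -/
lemma hasSupport_subsheafPair [Mono (mulHom ι I)] (Q : Subobject (dualQuotient ι I)) :
    (subsheafPair ι Q).HasSupport ι := fun U => by
  rw [Scheme.Hom.ker_apply]
  ext a
  rw [Module.mem_annihilator]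
  refine ⟨fun h => ?_, fun h (y : Γ(inverseImage ι Q, U.1)) => ?_⟩
  · have h1 : (toInverseImage ι Q).app U.1 (a • toCurve ι 1) = 0 := by
      rw [app_smul']
      exact h _
    have h2 := app_injective (toInverseImage ι Q) U.1 (h1.trans (map_zero _).symm)
    rw [smul_curve, mul_one] at h2
    exact h2
  · refine app_injective (inverseImageι Q) U.1 ?_
    refine (app_smul' (inverseImageι Q) a y).trans (Eq.trans ?_ (map_zero _).symm)
    exact smul_idealDual_eq_zero h _

lemma support_idealDual_subset : support (idealDual ι I) ⊆ Set.range ι := fun x hx => by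
  by_contra hr
  let V : X.Opens := ⟨(Set.range ι)ᶜ, ι.isClosedEmbedding.isClosed_range.isOpen_compl⟩
  refine notMem_support_iff.2 (fun U φ hxU => ⟨U ⊓ V, inf_le_left, ⟨hxU, hr⟩, ?_⟩) hx
  refine dual_ext fun W hW _ g => ?_
  have hW' : ι ⁻¹ᵁ W = ⊥ := by
    rw [eq_bot_iff]
    intro y hy
    exact (hW hy).2 ⟨y, rfl⟩
  have : Subsingleton Γ(C, ι ⁻¹ᵁ W) := by
    rw [hW']
    infer_instance
  exact Subsingleton.elim (α := Γ(C, ι ⁻¹ᵁ W)) _ _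

variable [IsLocallyNoetherian X]

/-- The support lies in $C$, of dimension at most one; being stable under specialization, it
contains the whole component with generic point `η`. -/
lemma IsCohenMacaulayCurve.topologicalKrullDim_support (hC : IsCohenMacaulayCurve C) {G : X.Modules}
    (hG : IsCoherent G) (hG' : support G ⊆ Set.range ι) {η : C} (hη : η ∈ genericPoints C)
    (hηG : ι η ∈ support G) : topologicalKrullDim (support G) = 1 := by
  refine le_antisymm ?_ ?_
  · rw [← Set.image_univ] at hG'
    refine (topologicalKrullDim_mono hG').trans ?_
    rw [topologicalKrullDim_image]
    exact (topologicalKrullDim_subspace_le C _).trans hC.topologicalKrullDim_le_one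
  · rw [← hC.topologicalKrullDim_closure hη, ← topologicalKrullDim_image (ι := ι)]
    refine topologicalKrullDim_mono ?_
    rintro _ ⟨y, hy, rfl⟩
    exact hG.mem_support_of_specializes
      ((specializes_iff_mem_closure.2 hy).map ι.continuous) hηG

/-- A nonzero section of a subsheaf is a homomorphism with some nonzero value in $\mathcal O_C$.
That value is nonzero near some generic point, which therefore lies in the support. -/
lemma isPure_inverseImage (hC : IsCohenMacaulayCurve C) (Q : Subobject (dualQuotient ι I)) :
    IsPure (inverseImage ι Q) := fun G i _ hG hG0 => by
  obtain ⟨U, s, hs⟩ : ∃ (U : X.Opens) (s : Γ(G, U)), s ≠ 0 := by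
    by_contra! h
    exact hG0 (isZero_of_forall_eq_zero h)
  let k := i ≫ inverseImageι Q
  have : Mono k := mono_comp _ _
  have hφ : k.app U s ≠ 0 := fun h => hs (app_injective k U (h.trans (map_zero _).symm))
  obtain ⟨V, hV, g, hg⟩ : ∃ (V : X.Opens) (hV : V ≤ U) (g : Γ(idealOn ι I, V)),
      dualApp (k.app U s) hV g ≠ 0 := by
    by_contra! h
    exact hφ (dual_ext fun V hV _ g => h V hV g)
  have h1 := mt (hC.eq_zero (f := (show Γ(C, ι ⁻¹ᵁ V) from dualApp (k.app U s) hV g))) hg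
  push Not at h1
  obtain ⟨η, hη, hηV, h2⟩ := h1
  refine hC.topologicalKrullDim_support hG
    ((support_subset_of_mono k).trans support_idealDual_subset) hη ?_
  by_contra hηG
  obtain ⟨W, hW, hηW, h0⟩ := notMem_support_iff.1 hηG U s (hV hηV)
  refine h2 (ι ⁻¹ᵁ (V ⊓ W)) (ι.preimage_mono inf_le_left) ⟨hηV, hηW⟩ ?_
  have h3 : res _ inf_le_left (dualApp (k.app U s) hV g) =
      dualApp (k.app U s) ((inf_le_left : V ⊓ W ≤ V).trans hV) (res _ inf_le_left g) :=
    res_dualApp _ _ _ _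
  refine h3.trans ?_
  have h4 : k.app W (res G hW s) = 0 := by rw [h0, map_zero]
  rw [app_res] at h4
  exact congr(dualApp $h4 inf_le_right _)

/-- The pair attached to a coherent subsheaf is a stable pair. -/
theorem isStableOn_subsheafPair (hC : IsCohenMacaulayCurve C) {m : C.IdealSheafData}
    (hm : topologicalKrullDim m.support ≤ 0) (r : ℕ) (Q : Subobject (dualQuotient ι (m ^ r)))
    (hQ : IsCoherent (Q : X.Modules)) : (subsheafPair ι Q).IsStableOn ι m := by
  have := mono_mulHom (ι := ι) hC hm r
  refine ⟨⟨isCoherent_of_shortExact (shortExact_subsheafSequence Q) (isCoherent_curveSheaf ι) hQ,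
    isPure_inverseImage hC Q, ?_⟩, hasSupport_subsheafPair Q, support_coker_subsheafPair r Q⟩
  refine (topologicalKrullDim_mono (support_coker_subsheafPair r Q)).trans ?_
  rw [topologicalKrullDim_image]
  exact hm

/-- The images of a coherent subsheaf under the transition maps give the same pair. -/
theorem isomorphic_transition (hC : IsCohenMacaulayCurve C) {m : C.IdealSheafData}
    (hm : topologicalKrullDim m.support ≤ 0) {r r' : ℕ} (h : r ≤ r')
    (Q : Subobject (dualQuotient ι (m ^ r))) (hQ : IsCoherent (Q : X.Modules)) :
    IsCoherent (imageSubobject (Q.arrow ≫ transition ι m h) : X.Modules) ∧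
      (subsheafPair ι Q).Isomorphic
        (subsheafPair ι (imageSubobject (Q.arrow ≫ transition ι m h))) := by
  have := mono_transition (ι := ι) hC hm h
  have := mono_dualRes (ι := ι) hC hm h
  have := isIso_factorThruImageSubobject (Q.arrow ≫ transition ι m h)
  refine ⟨isCoherent_of_iso (asIso (factorThruImageSubobject (Q.arrow ≫ transition ι m h))) hQ, ?_⟩
  have : Mono (inverseImageι Q ≫ dualRes ι (pow_anti m h)) := mono_comp _ _
  obtain ⟨e, he⟩ := exists_iso_inverseImage (toInverseImage ι Q)
    (inverseImageι Q ≫ dualRes ι (pow_anti m h))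
    (by rw [← Category.assoc, toInverseImage_ι, mulHom_precomp])
  have hc : cokernel.π (mulHom ι (m ^ r)) ≫ transition ι m h =
      dualRes ι (pow_anti m h) ≫ cokernel.π (mulHom ι (m ^ r')) :=
    π_comp_dualQuotientMap ι (pow_anti m h)
  -- $F_Q\to Q$ is epi, so $F_Q$ and $Q$ have the same image in the quotient for `r'`.
  have hQ' : imageSubobject ((inverseImageι Q ≫ dualRes ι (pow_anti m h)) ≫
      cokernel.π (mulHom ι (m ^ r'))) = imageSubobject (Q.arrow ≫ transition ι m h) := by
    rw [Category.assoc, ← hc, ← Category.assoc, ← pullback.condition, Category.assoc,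
      imageSubobject_epi_comp]
  rw [← hQ']
  exact ⟨e, (Category.assoc _ _ _).trans (curveSection ι ≫= he)⟩

end Subsheaf

/-! ### Sheaves annihilated by the ideal of a closed subscheme -/

section Annihilated

variable {X C : Scheme.{u}} (ι : C ⟶ X)

/-- Functions vanishing on the closed subscheme `ι : C ⟶ X` act as zero on `F`. -/
def IsAnnihilated (F : X.Modules) : Prop :=
  ∀ (U : X.Opens) (a : Γ(X, U)), ι.app U a = 0 → ∀ x : Γ(F, U), a • x = 0

/-- The functions on `U` whose restriction to `C` lies in the ideal `I`. -/
def liftedIdeal (I : C.IdealSheafData) (U : X.Opens) : Ideal Γ(X, U) :=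
  (idealSections I (ι ⁻¹ᵁ U)).comap (ι.app U).hom

variable {ι} {I : C.IdealSheafData} {F : X.Modules}

lemma mem_liftedIdeal {U : X.Opens} {a : Γ(X, U)} :
    a ∈ liftedIdeal ι I U ↔ ι.app U a ∈ idealSections I (ι ⁻¹ᵁ U) := Iff.rfl

lemma IsAnnihilated.smul_eq (h : IsAnnihilated ι F) {U : X.Opens} {a b : Γ(X, U)}
    (hab : ι.app U a = ι.app U b) (x : Γ(F, U)) : a • x = b • x := by
  rw [← sub_eq_zero, ← sub_smul]
  exact h U _ (by rw [map_sub, hab, sub_self]) x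

lemma IsAnnihilated.of_epi {G : X.Modules} (h : IsAnnihilated ι F) (p : F ⟶ G) [Epi p] :
    IsAnnihilated ι G := fun U a ha z => section_ext fun q hq => by
  obtain ⟨V, hV, hqV, y, hy⟩ := locallySurjective_of_epi p U z q hq
  refine ⟨V, hV, hqV, ?_⟩
  rw [res_smul, ← hy, ← app_smul', h V _ (by rw [← resR_app, ha, map_zero]), map_zero, map_zero]

/-- The subsheaf of sections killed by an ideal is coherent. -/
lemma isCoherent_of_mem_sections_iff [IsLocallyNoetherian X] (S : SubmoduleSheaf F)
    (hF : IsCoherent F) (hS : ∀ (U : X.Opens), IsAffineOpen U → ∀ x : Γ(F, U),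
      x ∈ S.sections U ↔ ∀ a ∈ liftedIdeal ι I U, a • x = 0) : IsCoherent S.toModules := by
  refine isCoherent_of_locally fun x => ?_
  obtain ⟨U, hU, hx⟩ := exists_affine_mem x
  have : Fact (IsAffineOpen U) := ⟨hU⟩
  have hl := hF.localizingAt hU
  refine ⟨U, hU, hx, ⟨fun f z => ?_, fun f t ht => ?_⟩, ?_⟩
  · obtain ⟨n, t, ht⟩ := hl.exists_lift f (S.ι.app _ z)
    obtain ⟨T, hT⟩ := IsNoetherian.noetherian (liftedIdeal ι I U)
    have h1 (a : Γ(X, U)) : ∃ k : ℕ, a ∈ T → f ^ k • a • t = 0 := by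
      by_cases ha : a ∈ T
      · have ha' : a ∈ liftedIdeal ι I U := hT ▸ Submodule.subset_span ha
        obtain ⟨k, hk⟩ := hl.exists_pow_smul f (a • t) (by
          rw [res_smul, ht, smul_comm, (hS _ (hU.basicOpen f) _).1 (S.ι_app_mem z), smul_zero]
          rw [mem_liftedIdeal, ← resR_app]
          exact idealSections_res _ _ ha')
        exact ⟨k, fun _ => hk⟩
      · exact ⟨0, fun h => absurd h ha⟩
    choose k hk using h1
    -- The ideal is finitely generated, so one power of `f` makes all the generators kill the lifted
    -- section.
    have h2 : f ^ T.sup k • t ∈ S.sections U := by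
      rw [hS U hU]
      intro a ha
      rw [← hT] at ha
      induction ha using Submodule.span_induction with
      | mem a ha =>
        obtain ⟨l, hl⟩ := Nat.exists_eq_add_of_le' (Finset.le_sup (f := k) ha)
        rw [hl, pow_add, mul_smul, smul_comm a, smul_comm a, hk a ha, smul_zero]
      | zero => exact zero_smul _ _
      | add a b _ _ h h' => rw [add_smul, h, h', add_zero]
      | smul b a _ h => rw [smul_assoc, h, smul_zero]
    obtain ⟨w, hw⟩ := S.exists_ι_app h2
    refine ⟨T.sup k + n, w, app_injective S.ι _ ?_⟩
    rw [app_res, hw, res_smul, ht, app_smul', smul_smul, ← map_pow, pow_add]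
    simp
  · obtain ⟨n, hn⟩ := hl.exists_pow_smul f (S.ι.app _ t) (by rw [← app_res, ht, map_zero])
    exact ⟨n, app_injective S.ι _ (by rw [app_smul', hn, map_zero])⟩
  · have := finite_of_isCoherent hF hU
    exact Module.Finite.of_injective (appLinear S.ι U) (app_injective S.ι U)

variable [IsClosedImmersion ι]

lemma isAnnihilated_of_annihilator
    (h : ∀ U : X.affineOpens, Module.annihilator Γ(X, U.1) Γ(F, U.1) = ι.ker.ideal U) :
    IsAnnihilated ι F := fun U a ha x => section_ext fun p hp => by
  obtain ⟨V, hV, hpV, hVU⟩ := exists_affine_le hp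
  refine ⟨V, hVU, hpV, ?_⟩
  have h1 : resR hVU a ∈ ι.ker.ideal ⟨V, hV⟩ := by
    rw [Scheme.Hom.ker_apply]
    change ι.app V (resR hVU a) = 0
    rw [← resR_app, ha, map_zero]
  rw [← h, Module.mem_annihilator] at h1
  rw [res_smul, h1, map_zero]

/-- The product of a section of a sheaf annihilated by the ideal of `C` with a function on `C`. -/
lemma IsAnnihilated.exists_product (h : IsAnnihilated ι F) {V : X.Opens} (x : Γ(F, V))
    (g : Γ(C, ι ⁻¹ᵁ V)) : ∃ y : Γ(F, V), ∀ (W : X.Opens) (hW : W ≤ V) (a : Γ(X, W)),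
      ι.app W a = resR (ι.preimage_mono hW) g → res F hW y = a • res F hW x := by
  let J := {W : X.Opens // IsAffineOpen W ∧ W ≤ V}
  have hc : V ≤ ⨆ W : J, W.1 := fun p hp => by
    obtain ⟨W, hW, hpW, hWV⟩ := exists_affine_le hp
    exact Opens.mem_iSup.2 ⟨⟨W, hW, hWV⟩, hpW⟩
  choose a ha using fun W : J => ι.app_surjective W.1 W.2.1 (resR (ι.preimage_mono W.2.2) g)
  -- Two lifts of `g` to $X$ differ by a function vanishing on $C$, so the local products agree on
  -- overlaps.
  obtain ⟨y, hy⟩ := exists_glue (M := F) (fun W : J => W.1) (fun W => W.2.2) hc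
    (fun W => a W • res F W.2.2 x) (fun W W' => by
      rw [res_smul, res_smul, res_res, res_res]
      refine h.smul_eq ?_ _
      rw [← resR_app, ← resR_app, ha, ha, resR_resR, resR_resR])
  refine ⟨y, fun W hW b hb => section_ext fun p hp => ?_⟩
  obtain ⟨W', hW'a, hpW', hW'⟩ := exists_affine_le hp
  refine ⟨W', hW', hpW', ?_⟩
  have := hy ⟨W', hW'a, hW'.trans hW⟩
  rw [res_res, this, res_smul, res_res]
  refine h.smul_eq ?_ _
  rw [ha, ← resR_app, hb, resR_resR]

/-- A section over a basic open set `D(f) ⊆ U` killed by `I(U)` is killed by `I(D(f))`. -/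
lemma IsAnnihilated.smul_eq_zero_of_basicOpen (h : IsAnnihilated ι F) {U : X.Opens}
    (hU : IsAffineOpen U) {f : Γ(X, U)} {z : Γ(F, X.basicOpen f)}
    (hz : ∀ a ∈ liftedIdeal ι I U, resR (X.basicOpen_le f) a • z = 0) {a : Γ(X, X.basicOpen f)}
    (ha : a ∈ liftedIdeal ι I (X.basicOpen f)) : a • z = 0 := by
  have hf := hU.basicOpen f
  let U' : C.affineOpens := ⟨ι ⁻¹ᵁ U, hU.preimage ι⟩
  let V' : C.affineOpens := ⟨ι ⁻¹ᵁ X.basicOpen f, hf.preimage ι⟩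
  have hVU : V'.1 ≤ U'.1 := ι.preimage_mono (X.basicOpen_le f)
  -- By quasi-coherence, $I(D(f))$ is generated by restrictions from $I(U)$. Quantifying over all
  -- lifts `a` of `g` lets the induction choose convenient ones.
  have key : ∀ g ∈ (I.ideal U').map (C.presheaf.map (homOfLE hVU).op).hom,
      ∀ a : Γ(X, X.basicOpen f), ι.app _ a = g → a • z = 0 := by
    intro g hg
    refine Submodule.span_induction (p := fun g _ => ∀ a : Γ(X, X.basicOpen f),
      ι.app (X.basicOpen f) a = g → a • z = 0) ?_ ?_ ?_ ?_ hg
    · rintro _ ⟨g, hg, rfl⟩ a ha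
      obtain ⟨b, rfl⟩ := ι.app_surjective U hU g
      have hb : b ∈ liftedIdeal ι I U := by
        rw [mem_liftedIdeal]
        exact (idealSections_affine I U').symm ▸ hg
      rw [← hz b hb]
      exact h.smul_eq (ha.trans (resR_app ι _ b)) z
    · exact fun a ha => h _ a ha z
    · intro g g' _ _ hg hg' a ha
      obtain ⟨b, hb⟩ := ι.app_surjective _ hf g
      have := hg' (a - b) (by rw [map_sub, ha, hb, add_sub_cancel_left])
      rwa [sub_smul, hg b hb, sub_zero] at this
    · intro c g _ hg a ha
      obtain ⟨b, hb⟩ := ι.app_surjective _ hf g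
      obtain ⟨d, hd⟩ := ι.app_surjective _ hf c
      rw [h.smul_eq (a := a) (b := d * b) (by rw [ha, map_mul, hb, hd, smul_eq_mul]) z, mul_smul,
        hg b hb, smul_zero]
  exact key (ι.app _ a) ((I.map_ideal (U := V') (V := U') hVU).ge
    ((idealSections_affine I V').le ha)) a rfl

end Annihilated

/-! ### Stable pairs as subsheaves -/

section Embedding

variable {X C : Scheme.{u}} {ι : C ⟶ X} {I : C.IdealSheafData} {F : X.Modules}

/-- The section `s(c)` is the product of the section `x` of `F` with the function `g ∈ I`. -/
def IsProduct (s : curveSheaf ι ⟶ F) {V : X.Opens} (x : Γ(F, V)) (g : Γ(idealOn ι I, V))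
    (c : Γ(curveSheaf ι, V)) : Prop :=
  ∀ (W : X.Opens) (hW : W ≤ V), IsAffineOpen W → ∀ a : Γ(X, W),
    ι.app W a = idealFun ι (res _ hW g) → s.app W (res _ hW c) = a • res F hW x

lemma IsProduct.res {s : curveSheaf ι ⟶ F} {V : X.Opens} {x : Γ(F, V)} {g : Γ(idealOn ι I, V)}
    {c : Γ(curveSheaf ι, V)} (h : IsProduct s x g c) {V' : X.Opens} (hV : V' ≤ V) :
    IsProduct s (res F hV x) (res _ hV g) (res _ hV c) := fun W hW hWa a ha => by
  rw [res_res, res_res]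
  rw [res_res] at ha
  exact h W (hW.trans hV) hWa a ha

variable [IsClosedImmersion ι]

lemma IsProduct.unique {s : curveSheaf ι ⟶ F} [Mono s] {V : X.Opens} {x : Γ(F, V)}
    {g : Γ(idealOn ι I, V)} {c c' : Γ(curveSheaf ι, V)} (h : IsProduct s x g c)
    (h' : IsProduct s x g c') : c = c' := section_ext fun p hp => by
  obtain ⟨W, hWa, hpW, hW⟩ := exists_affine_le hp
  obtain ⟨a, ha⟩ := ι.app_surjective W hWa (idealFun ι (StablePairs.res _ hW g))
  exact ⟨W, hW, hpW, app_injective s W ((h W hW hWa a ha).trans (h' W hW hWa a ha).symm)⟩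

/-- If all products of sections of `I` and of `F` lie in `𝒪_C`, then `F` maps to
`ℋom(I, 𝒪_C)`. -/
theorem IsAnnihilated.exists_hom_idealDual (hF : IsAnnihilated ι F) (s : curveSheaf ι ⟶ F) [Mono s]
    (h : ∀ (V : X.Opens) (x : Γ(F, V)) (g : Γ(idealOn ι I, V)), ∃ c, IsProduct s x g c) :
    ∃ j : F ⟶ idealDual ι I, ∀ (U V : X.Opens) (hV : V ≤ U) (x : Γ(F, U)) (g : Γ(idealOn ι I, V)),
      IsProduct s (res F hV x) g (dualApp (j.app U x) hV g) := by
  choose c hc using h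
  -- As `s` is mono, products are unique; this makes the chosen ones bilinear and compatible with
  -- restriction.
  have hadd (V : X.Opens) (x : Γ(F, V)) (g g' : Γ(idealOn ι I, V)) :
      c V x (g + g') = c V x g + c V x g' := by
    refine (hc V x (g + g')).unique fun W hW hWa a ha => ?_
    obtain ⟨b, hb⟩ := ι.app_surjective W hWa (idealFun ι (res _ hW g))
    have hb' : ι.app W (a - b) = idealFun ι (res _ hW g') := by
      rw [map_sub, ha, hb, map_add]
      exact add_sub_cancel_left _ _
    rw [map_add, map_add, hc V x g W hW hWa b hb, hc V x g' W hW hWa _ hb', ← add_smul,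
      add_sub_cancel]
  have hsmul (V : X.Opens) (x : Γ(F, V)) (b : Γ(X, V)) (g : Γ(idealOn ι I, V)) :
      c V x (b • g) = b • c V x g := by
    refine (hc V x (b • g)).unique fun W hW hWa a ha => ?_
    obtain ⟨d, hd⟩ := ι.app_surjective W hWa (idealFun ι (res _ hW g))
    rw [res_smul, app_smul', hc V x g W hW hWa d hd, smul_smul]
    refine hF.smul_eq ?_ _
    rw [ha, map_mul, hd, res_smul, idealFun_smul]
  have hadd' (V : X.Opens) (x x' : Γ(F, V)) (g : Γ(idealOn ι I, V)) :
      c V (x + x') g = c V x g + c V x' g := by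
    refine (hc V (x + x') g).unique fun W hW hWa a ha => ?_
    rw [map_add, map_add, hc V x g W hW hWa a ha, hc V x' g W hW hWa a ha, map_add, smul_add]
  have hsmul' (V : X.Opens) (b : Γ(X, V)) (x : Γ(F, V)) (g : Γ(idealOn ι I, V)) :
      c V (b • x) g = b • c V x g := by
    refine (hc V (b • x) g).unique fun W hW hWa a ha => ?_
    rw [res_smul, app_smul', hc V x g W hW hWa a ha, res_smul, smul_smul, smul_smul, mul_comm]
  let φ (U : X.Opens) (x : Γ(F, U)) : homSections (idealOn ι I) (curveSheaf ι) U :=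
    ⟨fun V =>
      { toFun := c V.1 (res F V.2 x)
        map_add' := hadd V.1 _
        map_smul' := hsmul V.1 _ },
    fun V W hW g => by
      refine (hc W.1 (res F W.2 x) _).unique ?_
      have := (hc V.1 (res F V.2 x) g).res hW
      rw [res_res] at this
      exact this⟩
  refine ⟨mkHom (fun U =>
    { toFun := φ U
      map_add' := fun x x' => Subtype.ext <| funext fun V => LinearMap.ext fun g => by
        change c V.1 (res F V.2 (x + x')) g = c V.1 (res F V.2 x) g + c V.1 (res F V.2 x') g
        rw [map_add, hadd']
      map_smul' := fun b x => Subtype.ext <| funext fun V => LinearMap.ext fun g => by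
        change c V.1 (res F V.2 (b • x)) g = resR V.2 b • c V.1 (res F V.2 x) g
        rw [res_smul, hsmul'] })
    (fun U V hV x => Subtype.ext <| funext fun W => LinearMap.ext fun g => by
      change c W.1 (res F W.2 (res F hV x)) g = c W.1 (res F (W.2.trans hV) x) g
      rw [res_res]), fun U V hV x g => hc V _ g⟩

/-- Compatibility of `F ⟶ ℋom(I, 𝒪_C)` with the maps from `𝒪_C`. -/
lemma comp_eq_mulHom {s : curveSheaf ι ⟶ F} [Mono s] {j : F ⟶ idealDual ι I}
    (hj : ∀ (U V : X.Opens) (hV : V ≤ U) (x : Γ(F, U)) (g : Γ(idealOn ι I, V)),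
      IsProduct s (res F hV x) g (dualApp (j.app U x) hV g)) : s ≫ j = mulHom ι I := by
  refine hom_ext_sections fun U f => dual_ext fun V hV _ g => ?_
  refine (hj U V hV (s.app U f) g).unique fun W hW _ a ha => ?_
  rw [← app_res, ← app_res, ← app_smul']
  refine congr_arg (s.app W) ?_
  rw [res_dualApp]
  change (dualApp ((mulHom ι I).app U (toCurve ι (show Γ(C, ι ⁻¹ᵁ U) from f))) _ _) = _
  rw [dualApp_mulHom, ← ha, res_res, mul_comm]
  rfl

/-- The kernel of `F ⟶ ℋom(I, 𝒪_C)` consists of the sections killed by `I`. -/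
lemma mem_kernelSheaf_iff (hF' : IsAnnihilated ι F) {s : curveSheaf ι ⟶ F}
    [Mono s] {j : F ⟶ idealDual ι I}
    (hj : ∀ (U V : X.Opens) (hV : V ≤ U) (x : Γ(F, U)) (g : Γ(idealOn ι I, V)),
      IsProduct s (res F hV x) g (dualApp (j.app U x) hV g)) {U : X.Opens} (hU : IsAffineOpen U)
    (x : Γ(F, U)) :
    x ∈ (kernelSheaf j).sections U ↔ ∀ a ∈ liftedIdeal ι I U, a • x = 0 := by
  change j.app U x = 0 ↔ _
  refine ⟨fun h a ha => ?_, fun h => dual_ext fun V hV _ g => ?_⟩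
  · have h1 := hj U U le_rfl x (toIdeal ι _ ha) U le_rfl hU a (by rw [res_self]; rfl)
    rw [h] at h1
    rw [res_self, res_self, res_self] at h1
    exact h1.symm.trans (map_zero (s.app U).hom)
  · refine (hj U V hV x g).unique fun W hW _ a ha => ?_
    change s.app W (res _ hW 0) = _
    rw [map_zero, map_zero, res_res]
    -- The hypothesis concerns $I(U)$ only; it passes to basic opens of `U` inside `W`.
    refine section_ext fun p hp => ?_
    obtain ⟨f, hf, hpf⟩ := hU.exists_basicOpen_le (V := W) ⟨p, hp⟩ (hV (hW hp))
    refine ⟨X.basicOpen f, hf, hpf, ?_⟩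
    rw [map_zero, res_smul, res_res]
    refine (hF'.smul_eq_zero_of_basicOpen (I := I) hU (fun b hb => ?_) ?_).symm
    · rw [← res_smul, h b hb, map_zero]
    · rw [mem_liftedIdeal, ← resR_app, ha]
      exact idealSections_res _ _ (idealFun_mem ι _)

end Embedding

/-! ### Every stable pair is a subsheaf of `ℋom(𝔪^r, 𝒪_C)` -/

section StablePair

variable {X C : Scheme.{u}} {ι : C ⟶ X} [IsClosedImmersion ι] {m : C.IdealSheafData}
  {F G : X.Modules}

/-- The section of a pair with support `C` factors through `𝒪_C`. -/
lemma exists_curveSection_comp (hF : IsAnnihilated ι F) (s : structureSheaf X ⟶ F) :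
    ∃ t : curveSheaf ι ⟶ F, curveSection ι ≫ t = s := by
  -- A function $a$ in the kernel of $\mathcal O_X\to\mathcal O_C$ is sent to $a\,s(1)=0$.
  refine ⟨Abelian.epiDesc (curveSection ι) s (hom_ext_sections fun U z => ?_),
    Abelian.comp_epiDesc _ _ _⟩
  let a : Γ(X, U) := (kernel.ι (curveSection ι)).app U z
  have ha : ι.app U a = 0 := congr(($(kernel.condition (curveSection ι))).app U z)
  change s.app U a = 0
  have h1 : (show Γ(structureSheaf X, U) from a) = a • (show Γ(structureSheaf X, U) from (1 : Γ(X, U))) :=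
    (mul_one a).symm
  rw [h1, app_smul', hF U a ha]

section Noetherian

variable [IsLocallyNoetherian X]

/-- Near a point outside of the support of the cokernel, a morphism of coherent sheaves is
surjective on sections. -/
lemma exists_basicOpen_surjective (s : G ⟶ F) (hF : IsCoherent F)
    (hG : IsCoherent (cokernel s)) {U : X.Opens} {x : X} (hxU : x ∈ U)
    (hx : x ∉ support (cokernel s)) : ∃ V : X.Opens, IsAffineOpen V ∧ x ∈ V ∧ V ≤ U ∧
      Function.Surjective (s.app V) := by
  obtain ⟨W, hxW, hW⟩ := hG.exists_open_eq_zero hx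
  obtain ⟨V, hVa, hxV, hV⟩ := exists_affine_le (U := U ⊓ W) ⟨hxU, hxW⟩
  obtain ⟨T, hT⟩ := (finite_of_isCoherent hF hVa).fg_top
  obtain ⟨a, hxa, ha⟩ := exists_basicOpen_forall hVa hxV T
    (fun t V' => ∃ (hV : V' ≤ V) (y : Γ(G, V')), s.app V' y = res F hV t)
    (fun t V W hWV => by
      rintro ⟨hV, y, hy⟩
      exact ⟨hWV.trans hV, res G hWV y, by rw [app_res, hy, res_res]⟩)
    (fun t _ => by
      obtain ⟨V', hV', hxV', y, hy⟩ := exists_locally_of_cokernel_eq_zero s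
        (hW V (hV.trans inf_le_right) ((cokernel.π s).app V t)) x hxV
      exact ⟨V', hxV', hV', y, hy⟩)
  exact ⟨X.basicOpen a, hVa.basicOpen a, hxa, (X.basicOpen_le a).trans (hV.trans inf_le_left),
    surjective_basicOpen (hF.localizingAt hVa) s hT a fun t ht => (ha t ht).2⟩

/-- Near a generic point `s` is surjective, so a lift of an element of its kernel annihilates $F$
there. As the annihilator is exactly the ideal of $C$, the element vanishes near every generic
point, hence everywhere. -/
lemma mono_of_support_cokernel_subset (hC : IsCohenMacaulayCurve C)
    (hm : topologicalKrullDim m.support ≤ 0) (hF : IsCoherent F)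
    (hann : ∀ U : X.affineOpens, Module.annihilator Γ(X, U.1) Γ(F, U.1) = ι.ker.ideal U)
    (s : curveSheaf ι ⟶ F) (hs : support (cokernel s) ⊆ ι '' (m.support : Set C)) : Mono s := by
  refine mono_of_injective _ fun U => (injective_iff_map_eq_zero _).2 fun f hf => ?_
  refine hC.eq_zero (f := (show Γ(C, ι ⁻¹ᵁ U) from f)) fun η hη hηU => ?_
  have hη' : ι η ∉ support (cokernel s) := fun h => by
    obtain ⟨y, hy, e⟩ := hs h
    rw [ι.isEmbedding.injective e] at hy
    exact hC.notMem_of_dim_le_zero m.support.isClosed hm hη hy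
  obtain ⟨V, hVa, hηV, hV, hsurj⟩ := exists_basicOpen_surjective s hF
    (isCoherent_cokernel s (isCoherent_curveSheaf ι) hF) (x := ι η) hηU hη'
  refine ⟨ι ⁻¹ᵁ V, ι.preimage_mono hV, hηV, ?_⟩
  obtain ⟨a, ha⟩ := ι.app_surjective V hVa (resR (ι.preimage_mono hV) (show Γ(C, ι ⁻¹ᵁ U) from f))
  have h0 : s.app V (toCurve ι (ι.app V a)) = 0 := by
    rw [ha]
    exact (app_res s hV f).trans (by rw [hf, map_zero])
  have hmem : a ∈ Module.annihilator Γ(X, V) Γ(F, V) := by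
    rw [Module.mem_annihilator]
    intro y
    obtain ⟨g, rfl⟩ := hsurj y
    rw [← app_smul']
    obtain ⟨b, rfl⟩ := ι.app_surjective V hVa g
    change s.app V (a • toCurve ι (ι.app V b)) = 0
    rw [smul_curve, mul_comm, ← smul_curve, app_smul', h0, smul_zero]
  rw [hann ⟨V, hVa⟩, Scheme.Hom.ker_apply] at hmem
  exact ha.symm.trans hmem

/-- A coherent sheaf supported in the zero locus of `𝔪` is annihilated by a power of `𝔪`. -/
lemma exists_pow_smul_eq_zero (hG : IsCoherent G) (hG' : IsAnnihilated ι G)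
    (hs : support G ⊆ ι '' (m.support : Set C)) {U : X.Opens} (hU : IsAffineOpen U) :
    ∃ n : ℕ, ∀ r, n ≤ r → ∀ a ∈ liftedIdeal ι (m ^ r) U, ∀ y : Γ(G, U), a • y = 0 := by
  have : Fact (IsAffineOpen U) := ⟨hU⟩
  let U' : C.affineOpens := ⟨ι ⁻¹ᵁ U, hU.preimage ι⟩
  let J : Ideal Γ(X, U) := (m.ideal U').comap (ι.app U).hom
  have hsurj : Function.Surjective (ι.app U).hom := ι.app_surjective U hU
  obtain ⟨T, hT⟩ := (finite_of_isCoherent hG hU).fg_top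
  -- A section of $G$ restricted to $D(b)$ with $b\in J$ has empty support, so a power of $b$ kills
  -- it.
  have hrad : J ≤ (Module.annihilator Γ(X, U) Γ(G, U)).radical := by
    intro b hb
    have h0 (y : Γ(G, U)) : res G (X.basicOpen_le b) y = 0 := by
      by_contra hne
      obtain ⟨x, hxb, hx⟩ := exists_mem_support_of_ne_zero hne
      obtain ⟨c, hc, rfl⟩ := hs hx
      have hcb : c ∈ C.basicOpen (ι.app U b) := by
        rw [← Scheme.preimage_basicOpen]
        exact hxb
      have hcU : c ∈ U'.1 := X.basicOpen_le b hxb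
      have hc' := (Scheme.IdealSheafData.mem_support_iff_of_mem hcU).1 hc
      rw [Scheme.mem_zeroLocus_iff] at hc'
      exact hc' _ hb hcb
    have h1 (y : Γ(G, U)) : ∃ n : ℕ, b ^ n • y = 0 := (hG.localizingAt hU).exists_pow_smul b y (h0 y)
    choose n hn using h1
    refine ⟨T.sup n, ?_⟩
    rw [Module.mem_annihilator]
    intro y
    have hy : y ∈ Submodule.span Γ(X, U) (T : Set Γ(G, U)) := hT ▸ Submodule.mem_top
    induction hy using Submodule.span_induction with
    | mem y hy =>
      obtain ⟨k, hk⟩ := Nat.exists_eq_add_of_le' (Finset.le_sup (f := n) hy)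
      rw [hk, pow_add, mul_smul, hn, smul_zero]
    | zero => exact smul_zero _
    | add y y' _ _ h h' => rw [smul_add, h, h', add_zero]
    | smul a y _ h => rw [smul_comm, h, smul_zero]
  obtain ⟨n, hn⟩ := Ideal.exists_pow_le_of_le_radical_of_fg hrad (IsNoetherian.noetherian J)
  refine ⟨n, fun r hr a ha y => ?_⟩
  have h2 : ι.app U a ∈ (m.ideal U') ^ r := (idealSections_affine (m ^ r) U').le ha
  -- An element of $\mathfrak m^r$ lifts to $J^r$; two lifts act alike on `G`.
  rw [← Ideal.map_comap_of_surjective (ι.app U).hom hsurj (m.ideal U'), ← Ideal.map_pow] at h2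
  obtain ⟨a', ha', e⟩ := (Ideal.mem_map_iff_of_surjective _ hsurj).1 h2
  rw [hG'.smul_eq e.symm y]
  exact Module.mem_annihilator.1 (hn (Ideal.pow_le_pow_right hr ha')) y

/-- Products of sections of `𝔪^r` and of `F` lie in `𝒪_C` if `𝔪^r` annihilates `F/𝒪_C`. -/
lemma exists_isProduct (hF : IsCoherent F) (hF' : IsAnnihilated ι F) (s : curveSheaf ι ⟶ F) [Mono s]
    {I : C.IdealSheafData}
    (h : ∀ x : X, ∃ U : X.Opens, IsAffineOpen U ∧ x ∈ U ∧
      ∀ a ∈ liftedIdeal ι I U, ∀ y : Γ(cokernel s, U), a • y = 0)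
    (V : X.Opens) (x : Γ(F, V)) (g : Γ(idealOn ι I, V)) : ∃ c, IsProduct s x g c := by
  have hco := isCoherent_cokernel s (isCoherent_curveSheaf ι) hF
  have hco' := hF'.of_epi (cokernel.π s)
  obtain ⟨y, hy⟩ := hF'.exists_product x (idealFun ι g)
  have h0 : (cokernel.π s).app V y = 0 := section_ext fun p hp => by
    obtain ⟨U, hU, hpU, hann⟩ := h p
    obtain ⟨f, hf, hpf⟩ := hU.exists_basicOpen_le (V := V) ⟨p, hp⟩ hpU
    refine ⟨X.basicOpen f, hf, hpf, ?_⟩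
    obtain ⟨a, ha⟩ := ι.app_surjective _ (hU.basicOpen f) (idealFun ι (res _ hf g))
    rw [map_zero, ← app_res, hy _ hf a ha, app_smul']
    -- Annihilation is known only for sections over `U`, so the class of `x` over $D(f)$ is first
    -- multiplied by a power of `f` that extends it to `U`.
    obtain ⟨n, t, ht⟩ := (hco.localizingAt hU).exists_lift f ((cokernel.π s).app _ (res F hf x))
    refine hco'.smul_eq_zero_of_basicOpen (I := I) hU (fun b hb => ?_) ?_
    · refine eq_zero_of_pow_smul (f := f) (n := n) le_rfl ?_
      rw [smul_comm]
      refine (congr_arg _ ht.symm).trans ?_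
      rw [← res_smul, hann b hb, map_zero]
    · rw [mem_liftedIdeal, ha]
      exact idealFun_mem ι _
  obtain ⟨c, hc⟩ := exists_of_cokernel_eq_zero s h0
  refine ⟨c, fun W hW _ a ha => ?_⟩
  rw [app_res, hc]
  exact hy W hW a ha

/-- The kernel consists of the sections killed by $\mathfrak m^r$, so it is coherent and vanishes
wherever $\mathfrak m^r$ contains a unit. Its support has dimension at most zero, which purity
forbids unless the kernel is zero. -/
lemma mono_of_isPure (hm : topologicalKrullDim m.support ≤ 0) (hF : IsCoherent F)
    (hF' : IsAnnihilated ι F) (hp : IsPure F) {s : curveSheaf ι ⟶ F} [Mono s] {r : ℕ}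
    {j : F ⟶ idealDual ι (m ^ r)}
    (hj : ∀ (U V : X.Opens) (hV : V ≤ U) (x : Γ(F, U)) (g : Γ(idealOn ι (m ^ r), V)),
      IsProduct s (res F hV x) g (dualApp (j.app U x) hV g)) : Mono j := by
  have hmem {U : X.Opens} (hU : IsAffineOpen U) (x : Γ(F, U)) :=
    mem_kernelSheaf_iff hF' hj hU x
  have hco : IsCoherent (kernelSheaf j).toModules :=
    isCoherent_of_mem_sections_iff _ hF fun U hU x => hmem hU x
  have hsupp : support (kernelSheaf j).toModules ⊆ ι '' (m.support : Set C) := fun x hx => by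
    by_contra hxm
    refine notMem_support_iff.2 (fun U k hxU => ?_) hx
    obtain ⟨V, hVa, hV, hxV, a, ha, ha'⟩ := exists_isUnit_mem hxm r hxU
    refine ⟨V, hV, hxV, app_injective (kernelSheaf j).ι V ?_⟩
    rw [map_zero]
    exact ha.smul_eq_zero.1 ((hmem hVa _).1 ((kernelSheaf j).ι_app_mem _) a ha')
  have hzero : IsZero (kernelSheaf j).toModules := by
    by_contra hne
    have h1 := hp _ (kernelSheaf j).ι inferInstance hco hne
    have h2 := (topologicalKrullDim_mono hsupp).trans (topologicalKrullDim_image (ι := ι) _).le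
    exact absurd (h1.symm.le.trans (h2.trans hm)) (by decide)
  refine mono_of_injective _ fun U => (injective_iff_map_eq_zero _).2 fun x hx => ?_
  obtain ⟨z, hz⟩ := (kernelSheaf j).exists_ι_app (y := x) hx
  rw [← hz, show (kernelSheaf j).ι = 0 from hzero.eq_of_src _ _]
  rfl

end Noetherian

theorem exists_subobject_of_isStableOn [IsNoetherian X] (hC : IsCohenMacaulayCurve C)
    (hm : topologicalKrullDim m.support ≤ 0) (P : SheafPair X) (hP : P.IsStableOn ι m) :
    ∃ r₀ : ℕ, ∀ r, r₀ ≤ r → ∃ Q : Subobject (dualQuotient ι (m ^ r)),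
      IsCoherent (Q : X.Modules) ∧ P.Isomorphic (subsheafPair ι Q) := by
  obtain ⟨⟨hF, hp, -⟩, hann, hs⟩ := hP
  have hF' := isAnnihilated_of_annihilator hann
  obtain ⟨t, ht⟩ := exists_curveSection_comp hF' P.s
  have ht' : support (cokernel t) ⊆ ι '' (m.support : Set C) := by
    let e : cokernel P.s ⟶ cokernel t := cokernel.desc P.s (cokernel.π t) (by
      rw [← ht, Category.assoc, cokernel.condition, comp_zero])
    have he : cokernel.π P.s ≫ e = cokernel.π t := cokernel.π_desc _ _ _
    have : Epi e := epi_of_epi_fac he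
    exact (support_subset_of_epi e).trans hs
  have := mono_of_support_cokernel_subset hC hm hF hann t ht'
  have hco := isCoherent_cokernel t (isCoherent_curveSheaf ι) hF
  have hco' := hF'.of_epi (cokernel.π t)
  choose U hU hxU using fun x : X => exists_affine_mem x
  choose n hn using fun x : X => exists_pow_smul_eq_zero hco hco' ht' (hU x)
  -- The exponent found on each affine open becomes uniform by quasi-compactness of $X$.
  obtain ⟨T, -, hT⟩ := (isCompact_univ (X := X)).elim_nhds_subcover (fun x => (U x : Set X))
    fun x _ => (U x).2.mem_nhds (hxU x)
  refine ⟨T.sup n, fun r hr => ?_⟩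
  obtain ⟨j, hj⟩ := hF'.exists_hom_idealDual (I := m ^ r) t (exists_isProduct hF hF' t fun x => by
    obtain ⟨y, hy, hxy⟩ := Set.mem_iUnion₂.1 (hT (Set.mem_univ x))
    exact ⟨U y, hU y, hxy, hn y r ((Finset.le_sup hy).trans hr)⟩)
  have := mono_of_isPure hm hF hF' hp hj
  have hcomp := comp_eq_mulHom hj
  obtain ⟨e⟩ := nonempty_cokernel_iso_imageSubobject t j hcomp
  obtain ⟨e', he'⟩ := exists_iso_inverseImage t j hcomp
  refine ⟨imageSubobject (j ≫ cokernel.π (mulHom ι (m ^ r))), isCoherent_of_iso e hco, e', ?_⟩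
  rw [← ht]
  exact (Category.assoc _ _ _).trans (curveSection ι ≫= he')

end StablePair

end

end StablePairs

/-! ### The correspondence between stable pairs and coherent subsheaves -/

theorem mainTheorem7 {X C : Scheme.{u}} [IsNoetherian X] (ι : C ⟶ X) [IsClosedImmersion ι]
    (hC : StablePairs.IsCohenMacaulayCurve C) (m : C.IdealSheafData)
    (hm : topologicalKrullDim m.support ≤ 0) :
    -- a coherent subsheaf `Q` of `ℋom(𝔪^r, 𝒪_C)/𝒪_C` gives a stable pair with cokernel `Q`
    (∀ (r : ℕ) (Q : Subobject (StablePairs.dualQuotient ι (m ^ r))),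
      StablePairs.IsCoherent (Q : X.Modules) →
        (StablePairs.subsheafPair ι Q).IsStableOn ι m ∧
        (StablePairs.subsheafSequence ι Q).ShortExact) ∧
    -- distinct coherent subsheaves give non-isomorphic pairs
    (∀ (r : ℕ) (Q Q' : Subobject (StablePairs.dualQuotient ι (m ^ r))),
      StablePairs.IsCoherent (Q : X.Modules) → StablePairs.IsCoherent (Q' : X.Modules) →
        (StablePairs.subsheafPair ι Q).Isomorphic (StablePairs.subsheafPair ι Q') → Q = Q') ∧
    -- every such stable pair arises, for all `r ≫ 0`
    (∀ P : StablePairs.SheafPair X, P.IsStableOn ι m →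
      ∃ r₀ : ℕ, ∀ r, r₀ ≤ r → ∃ Q : Subobject (StablePairs.dualQuotient ι (m ^ r)),
        StablePairs.IsCoherent (Q : X.Modules) ∧
        P.Isomorphic (StablePairs.subsheafPair ι Q)) ∧
    -- the correspondences for different `r` are compatible with the inclusions
    (∀ (r r' : ℕ) (h : r ≤ r'), Mono (StablePairs.transition ι m h) ∧
      ∀ Q : Subobject (StablePairs.dualQuotient ι (m ^ r)),
        StablePairs.IsCoherent (Q : X.Modules) →
          StablePairs.IsCoherent
            (imageSubobject (Q.arrow ≫ StablePairs.transition ι m h) : X.Modules) ∧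
          (StablePairs.subsheafPair ι Q).Isomorphic (StablePairs.subsheafPair ι
            (imageSubobject (Q.arrow ≫ StablePairs.transition ι m h)))) := by
  refine ⟨fun r Q hQ => ?_, fun r Q Q' _ _ h => ?_, fun P hP => ?_, fun r r' h => ?_⟩
  · have := StablePairs.mono_mulHom (ι := ι) hC hm r
    exact ⟨StablePairs.isStableOn_subsheafPair hC hm r Q hQ,
      StablePairs.shortExact_subsheafSequence Q⟩
  · have := StablePairs.mono_mulHom (ι := ι) hC hm r
    exact StablePairs.subobject_eq_of_isomorphic h
  · exact StablePairs.exists_subobject_of_isStableOn hC hm P hP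
  · exact ⟨StablePairs.mono_transition hC hm h, StablePairs.isomorphic_transition hC hm h⟩
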